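/- All alphabets below ($\mathcal S_1,\mathcal S_2,\mathcal X,\mathcal Y_1,\mathcal Y_2$) are finite and non-empty, and all information quantities are in bits. Let $p_{(S_1,S_2)}$ be a probability distribution on $\mathcal S_1\times\mathcal S_2$, let $p_{Y_1,Y_2|X}$ be a discrete memoryless broadcast channel with input alphabet $\mathcal X$ and output alphabets $\mathcal Y_1,\mathcal Y_2$, and let $\kappa$ be a real number. *Admissibility.* $p_{(S_1,S_2)}$ is admissible for $p_{Y_1,Y_2|X}$ subject to bandwidth expansion constraint $\kappa$ if for every $\epsilon>0$ there are integers $m\ge 1$, $n\ge 0$ with $n/m\le\kappa+\epsilon$, an encoding function $f:\mathcal S_1^m\times\mathcal S_2^m\to\mathcal X^n$ and decoding functions $g_i:\mathcal Y_i^n\to\mathcal S_i^m$, $i=1,2$, such that $$\frac1m\sum_{t=1}^m\Pr\big(S_i(t)\ne\hat S_i(t)\big)\le\epsilon,\quad i=1,2,$$ where $(S_1(t),S_2(t))$, $t=1,\dots,m$, are i.i.d. with distribution $p_{(S_1,S_2)}$, the block $f(S_1^m,S_2^m)$ is sent over $n$ uses of the memoryless channel with outputs $Y_1^n,Y_2^n$,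 and $\hat S_i^m=g_i(Y_i^n)$. *Source region.* $\mathcal C(p_{(S_1,S_2)})$ is the set of $(R_0,R_1,R_2)\in\mathbb R_+^3$ satisfying \begin{align*} &R_0\le\min\{I(U;S_1),I(U;S_2)\},\\ &R_0+R_i\le\min\{I(U;S_1),I(U;S_2)\}+H(S_i|U),\quad i=1,2,\\ &R_0+R_1+R_2\le\min\{I(U;S_1),I(U;S_2)\}+H(S_1,S_2|U) \end{align*} for some $p_{U,(S_1,S_2)}=p_{U|(S_1,S_2)}p_{(S_1,S_2)}$ with $|\mathcal U|\le|\mathcal S_1||\mathcal S_2|+2$. *Outer region.* For a distribution $p_X$ on $\mathcal X$, $\mathcal C_{\mathsf{out}}(p_X,p_{Y_1,Y_2|X})$ is the set of $(R_0,R_1,R_2)\in\mathbb R_+^3$ satisfying \begin{align*} &R_0\le\min\{I(V_0;Y_1),I(V_0;Y_2)\},\\ &R_0+R_i\le\min\{I(V_0;Y_1),I(V_0;Y_2)\}+I(V_i;Y_i|V_0),\quad i=1,2,\\ &R_0+R_1+R_2\le\min\{I(V_0;Y_1),I(V_0;Y_2)\}+I(V_1;Y_1|V_0)+I(X;Y_2|V_0,V_1),\\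 &R_0+R_1+R_2\le\min\{I(V_0;Y_1),I(V_0;Y_2)\}+I(V_2;Y_2|V_0)+I(X;Y_1|V_0,V_2) \end{align*} for some finite-alphabet $V_0,V_1,V_2$ with $p_{V_0,V_1,V_2,X,Y_1,Y_2}=p_{V_0,V_1,V_2|X}\,p_X\,p_{Y_1,Y_2|X}$. **Statement.** If $p_{(S_1,S_2)}$ is admissible for $p_{Y_1,Y_2|X}$ subject to bandwidth expansion constraint $\kappa$, then there exists an input distribution $p_X$ on $\mathcal X$ such that $$\mathcal C(p_{(S_1,S_2)})\subseteq\kappa\,\mathcal C_{\mathsf{out}}(p_X,p_{Y_1,Y_2|X}),$$ where $\kappa A=\{\kappa a:a\in A\}$. -/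

import Mathlib

open scoped Pointwise

noncomputable section

namespace CorrelatedBroadcast

/-- `W` is a conditional distribution (a channel) from `A` to `B`: each `W a` is a probability
mass function on the finite set `B`. -/
def IsChannel {A B : Type*} [Fintype B] (W : A → B → ℝ) : Prop :=
  ∀ a, W a ∈ stdSimplex ℝ B

open Classical in
/-- Probability of the event `E` under the probability mass function `P`. -/
def prob {Ω : Type*} [Fintype Ω] (P : Ω → ℝ) (E : Ω → Prop) : ℝ :=
  ∑ ω, if E ω then P ω else 0

/-- The probability mass function of the random variable `f` under `P`. -/
def law {Ω A : Type*} [Fintype Ω] (P : Ω → ℝ) (f : Ω → A) (a : A) : ℝ :=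
  prob P (fun ω => f ω = a)

/-- The entropy `H(f)`, in bits. -/
def entropy {Ω A : Type*} [Fintype Ω] [Fintype A] (P : Ω → ℝ) (f : Ω → A) : ℝ :=
  (∑ a, Real.negMulLog (law P f a)) / Real.log 2

/-- The conditional entropy `H(f | g)`. -/
def condEntropy {Ω A B : Type*} [Fintype Ω] [Fintype A] [Fintype B]
    (P : Ω → ℝ) (f : Ω → A) (g : Ω → B) : ℝ :=
  entropy P (fun ω => (f ω, g ω)) - entropy P g

/-- The mutual information `I(f ; g)`. -/
def mutualInfo {Ω A B : Type*} [Fintype Ω] [Fintype A] [Fintype B]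
    (P : Ω → ℝ) (f : Ω → A) (g : Ω → B) : ℝ :=
  entropy P f - condEntropy P f g

/-- The conditional mutual information `I(f ; g | h)`. -/
def condMutualInfo {Ω A B C : Type*} [Fintype Ω] [Fintype A] [Fintype B] [Fintype C]
    (P : Ω → ℝ) (f : Ω → A) (g : Ω → B) (h : Ω → C) : ℝ :=
  condEntropy P f h - condEntropy P f (fun ω => (g ω, h ω))

/-- The joint distribution of the source blocks `S₁ᵐ, S₂ᵐ` (i.i.d. pairs with distribution `p`)
and the channel output blocks `Y₁ⁿ, Y₂ⁿ`, when `f` is the encoder and its output is sent over the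
memoryless broadcast channel `W`. An outcome is `(s₁, s₂, y₁, y₂)`. -/
def codeJoint {S₁ S₂ X Y₁ Y₂ : Type*} {m n : ℕ}
    (p : S₁ × S₂ → ℝ) (W : X → Y₁ × Y₂ → ℝ)
    (f : (Fin m → S₁) → (Fin m → S₂) → (Fin n → X)) :
    (Fin m → S₁) × (Fin m → S₂) × (Fin n → Y₁) × (Fin n → Y₂) → ℝ :=
  fun ω =>
    (∏ t, p (ω.1 t, ω.2.1 t)) *
      ∏ q, W (f ω.1 ω.2.1 q) (ω.2.2.1 q, ω.2.2.2 q)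

/-- The source distribution `p` of `(S₁, S₂)` is admissible for the broadcast channel `W` subject
to bandwidth expansion constraint `κ`. Here `m ≥ 1` is the source block length, `n` is the number
of channel uses, and `n / m` is the bandwidth expansion ratio. -/
def IsAdmissible {S₁ S₂ X Y₁ Y₂ : Type*} [Fintype S₁] [Fintype S₂] [Fintype Y₁] [Fintype Y₂]
    (p : S₁ × S₂ → ℝ) (W : X → Y₁ × Y₂ → ℝ) (κ : ℝ) : Prop :=
  ∀ ε : ℝ, 0 < ε → ∃ m n : ℕ, 0 < m ∧ (n : ℝ) / (m : ℝ) ≤ κ + ε ∧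
    ∃ (f : (Fin m → S₁) → (Fin m → S₂) → (Fin n → X))
      (g₁ : (Fin n → Y₁) → (Fin m → S₁)) (g₂ : (Fin n → Y₂) → (Fin m → S₂)),
      (1 / (m : ℝ)) * ∑ t, prob (codeJoint p W f) (fun ω => ω.1 t ≠ g₁ ω.2.2.1 t) ≤ ε ∧
      (1 / (m : ℝ)) * ∑ t, prob (codeJoint p W f) (fun ω => ω.2.1 t ≠ g₂ ω.2.2.2 t) ≤ ε

/-- The joint distribution `p_{U|(S₁,S₂)} p_{(S₁,S₂)}`. An outcome is `(u, s₁, s₂)`. -/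
def sourceJoint {U S₁ S₂ : Type*} (p : S₁ × S₂ → ℝ) (K : S₁ × S₂ → U → ℝ) :
    U × S₁ × S₂ → ℝ :=
  fun ω => K ω.2 ω.1 * p ω.2

/-- The region `C(p_{(S₁,S₂)})` of rate triples. -/
def sourceRegion {S₁ S₂ : Type*} [Fintype S₁] [Fintype S₂] (p : S₁ × S₂ → ℝ) :
    Set (ℝ × ℝ × ℝ) :=
  {R | 0 ≤ R.1 ∧ 0 ≤ R.2.1 ∧ 0 ≤ R.2.2 ∧
    ∃ k : ℕ, k ≤ Fintype.card S₁ * Fintype.card S₂ + 2 ∧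
    ∃ K : S₁ × S₂ → Fin k → ℝ, IsChannel K ∧
      let P := sourceJoint p K
      let U : Fin k × S₁ × S₂ → Fin k := fun ω => ω.1
      let A₁ : Fin k × S₁ × S₂ → S₁ := fun ω => ω.2.1
      let A₂ : Fin k × S₁ × S₂ → S₂ := fun ω => ω.2.2
      let A : Fin k × S₁ × S₂ → S₁ × S₂ := fun ω => ω.2
      R.1 ≤ min (mutualInfo P U A₁) (mutualInfo P U A₂) ∧
      R.1 + R.2.1 ≤ min (mutualInfo P U A₁) (mutualInfo P U A₂) + condEntropy P A₁ U ∧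
      R.1 + R.2.2 ≤ min (mutualInfo P U A₁) (mutualInfo P U A₂) + condEntropy P A₂ U ∧
      R.1 + R.2.1 + R.2.2 ≤
        min (mutualInfo P U A₁) (mutualInfo P U A₂) + condEntropy P A U}

/-- The joint distribution `p_{V₀,V₁,V₂|X} p_X p_{Y₁,Y₂|X}`.
An outcome is `((v₀, v₁, v₂), x, (y₁, y₂))`. -/
def channelJoint {V X Y : Type*} (K : X → V → ℝ) (pX : X → ℝ) (W : X → Y → ℝ) :
    V × X × Y → ℝ :=
  fun ω => K ω.2.1 ω.1 * pX ω.2.1 * W ω.2.1 ω.2.2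

/-- The region `C_out(p_X, p_{Y₁,Y₂|X})` of rate triples. The auxiliary variables `V₀, V₁, V₂` range
over all finite alphabets. -/
def outerRegion {X Y₁ Y₂ : Type*} [Fintype X] [Fintype Y₁] [Fintype Y₂]
    (pX : X → ℝ) (W : X → Y₁ × Y₂ → ℝ) : Set (ℝ × ℝ × ℝ) :=
  {R | 0 ≤ R.1 ∧ 0 ≤ R.2.1 ∧ 0 ≤ R.2.2 ∧
    ∃ (k₀ k₁ k₂ : ℕ) (K : X → Fin k₀ × Fin k₁ × Fin k₂ → ℝ), IsChannel K ∧
      let Ω := (Fin k₀ × Fin k₁ × Fin k₂) × X × (Y₁ × Y₂)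
      let P : Ω → ℝ := channelJoint K pX W
      let V₀ : Ω → Fin k₀ := fun ω => ω.1.1
      let V₁ : Ω → Fin k₁ := fun ω => ω.1.2.1
      let V₂ : Ω → Fin k₂ := fun ω => ω.1.2.2
      let V₀₁ : Ω → Fin k₀ × Fin k₁ := fun ω => (V₀ ω, V₁ ω)
      let V₀₂ : Ω → Fin k₀ × Fin k₂ := fun ω => (V₀ ω, V₂ ω)
      let X' : Ω → X := fun ω => ω.2.1
      let B₁ : Ω → Y₁ := fun ω => ω.2.2.1
      let B₂ : Ω → Y₂ := fun ω => ω.2.2.2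
      R.1 ≤ min (mutualInfo P V₀ B₁) (mutualInfo P V₀ B₂) ∧
      R.1 + R.2.1 ≤
        min (mutualInfo P V₀ B₁) (mutualInfo P V₀ B₂) + condMutualInfo P V₁ B₁ V₀ ∧
      R.1 + R.2.2 ≤
        min (mutualInfo P V₀ B₁) (mutualInfo P V₀ B₂) + condMutualInfo P V₂ B₂ V₀ ∧
      R.1 + R.2.1 + R.2.2 ≤
        min (mutualInfo P V₀ B₁) (mutualInfo P V₀ B₂) + condMutualInfo P V₁ B₁ V₀
          + condMutualInfo P X' B₂ V₀₁ ∧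
      R.1 + R.2.1 + R.2.2 ≤
        min (mutualInfo P V₀ B₁) (mutualInfo P V₀ B₂) + condMutualInfo P V₂ B₂ V₀
          + condMutualInfo P X' B₁ V₀₂}

end CorrelatedBroadcast

end

/-! The theorem is a converse. For a triple of the source region, draw a block `U^m` from the source
block through `K`, letter by letter; the encoder ignores it. By Fano's inequality `H(S_i^m | Y_i^n)`
is at most `m` times a quantity that vanishes with the error. Hence the source quantities, times
`m`, are bounded by differences of output block entropies, conditioned on `U^m`, on `(U^m, S_1^m)`,
on `(U^m, S_2^m)` and on the whole message (`mutualInfo_le_of_equivocation`,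
`condEntropy_le_of_equivocation`).

These entropies are reduced to single letters with Csiszár's variable `V_q`: the first outputs
before time `q` and the second outputs after it. For every message variable `M`, the difference
`H(Y_i^n | M) - ∑ H(Y_iq | M, V_q)` is nonnegative and the same for both receivers
(`sum_condEntropy_mixed_sub`, `sum_condEntropy_mixed_le`). In each of the five bounds such
corrections cancel or have the favourable sign.

The alphabet of `V_q` grows with `n`, so no limit of the auxiliary variables themselves is taken.
The bounds involve them only through output entropies, which depend on the conditional laws of the
input. The resulting vectors lie in `layeredHull`, which is convex (this replaces a time-sharing
variable) and compact (Carathéodory). The average input distribution of a code does not depend on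
`K`, so its limit serves every triple. Finally each point of the hull is realised by actual
variables `V₀, V₁, V₂` (`mem_outerRegion_of_satisfiesOuterBounds`), and the limiting ratio `r ≤ κ`
is replaced by `κ`. -/

set_option linter.unusedSectionVars false

noncomputable section

namespace CorrelatedBroadcast

/-! ### Shannon entropy on finite probability spaces. -/

section Entropy

variable {Ω A B C D : Type*} [Fintype Ω] [Fintype A] [Fintype B] [Fintype C] [Fintype D]

/-- The entropy, in bits, of a vector of weights. -/
def hent (v : A → ℝ) : ℝ := (∑ a, Real.negMulLog (v a)) / Real.log 2

theorem entropy_eq_hent (P : Ω → ℝ) (f : Ω → A) : entropy P f = hent (law P f) := rfl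

theorem log_two_pos : 0 < Real.log 2 := Real.log_pos one_lt_two

theorem IsChannel.nonneg {c : D → A → ℝ} (hc : IsChannel c) (d : D) (a : A) : 0 ≤ c d a :=
  (hc d).1 a

theorem IsChannel.sum_eq_one {c : D → A → ℝ} (hc : IsChannel c) (d : D) : ∑ a, c d a = 1 :=
  (hc d).2

theorem hent_nonneg {v : A → ℝ} (hv : v ∈ stdSimplex ℝ A) : 0 ≤ hent v := by
  refine div_nonneg (Finset.sum_nonneg fun a _ => ?_) log_two_pos.le
  refine Real.negMulLog_nonneg (hv.1 a) ?_
  rw [← hv.2]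
  exact Finset.single_le_sum (fun i _ => hv.1 i) (Finset.mem_univ a)

/-- Jensen's inequality for the entropy. -/
theorem sum_mul_hent_le {ι : Type*} [Fintype ι] {w : ι → ℝ} (hw : w ∈ stdSimplex ℝ ι)
    {v : ι → A → ℝ} (hv : ∀ i a, 0 ≤ v i a) :
    ∑ i, w i * hent (v i) ≤ hent (fun a => ∑ i, w i * v i a) := by
  simp only [hent, ← mul_div_assoc, ← Finset.sum_div, Finset.mul_sum]
  refine div_le_div_of_nonneg_right ?_ log_two_pos.le
  rw [Finset.sum_comm]
  refine Finset.sum_le_sum fun a _ => ?_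
  have := Real.concaveOn_negMulLog.le_map_sum (t := Finset.univ) (w := w) (p := fun i => v i a)
    (fun i _ => hw.1 i) hw.2 (fun i _ => hv i a)
  simpa using this

theorem law_nonneg {P : Ω → ℝ} (hP : ∀ ω, 0 ≤ P ω) (f : Ω → A) (a : A) : 0 ≤ law P f a :=
  Finset.sum_nonneg fun ω _ => by split_ifs <;> simp [hP]

theorem prob_nonneg {P : Ω → ℝ} (hP : ∀ ω, 0 ≤ P ω) (e : Ω → Prop) : 0 ≤ prob P e :=
  Finset.sum_nonneg fun ω _ => by split_ifs <;> simp [hP]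

theorem sum_law_mul (P : Ω → ℝ) (f : Ω → A) (g : A → ℝ) :
    ∑ a, law P f a * g a = ∑ ω, P ω * g (f ω) := by
  classical
  simp only [law, prob, Finset.sum_mul]
  rw [Finset.sum_comm]
  refine Finset.sum_congr rfl fun ω _ => ?_
  simp [ite_mul]

theorem law_mem_stdSimplex {P : Ω → ℝ} (hP : P ∈ stdSimplex ℝ Ω) (f : Ω → A) :
    law P f ∈ stdSimplex ℝ A :=
  ⟨law_nonneg hP.1 f, by simpa [hP.2] using sum_law_mul P f (fun _ => 1)⟩

theorem law_eq_sum_ite [DecidableEq A] (P : Ω → ℝ) (f : Ω → A) (a : A) :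
    law P f a = ∑ ω, P ω * (if f ω = a then 1 else 0) := by
  simp only [law, prob]
  refine Finset.sum_congr rfl fun ω _ => ?_
  split_ifs <;> simp

theorem sum_law_fst (P : Ω → ℝ) (f : Ω → A) (g : Ω → B) (b : B) :
    ∑ a, law P (fun ω => (f ω, g ω)) (a, b) = law P g b := by
  classical
  simp only [law_eq_sum_ite]
  rw [Finset.sum_comm]
  refine Finset.sum_congr rfl fun ω _ => ?_
  rw [← Finset.mul_sum]
  by_cases h : g ω = b <;> simp [h, Prod.ext_iff]

theorem law_comp (P : Ω → ℝ) (f : Ω → A) (φ : A → B) :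
    law P (fun ω => φ (f ω)) = law (law P f) φ := by
  classical
  ext b
  rw [law_eq_sum_ite, law_eq_sum_ite, sum_law_mul P f (fun a => if φ a = b then 1 else 0)]

theorem entropy_injective (P : Ω → ℝ) (f : Ω → A) {e : A → B} (he : Function.Injective e) :
    entropy P (fun ω => e (f ω)) = entropy P f := by
  unfold entropy
  congr 1
  symm
  refine Fintype.sum_of_injective e he _ _ ?_ ?_
  · intro b hb
    have : law P (fun ω => e (f ω)) b = 0 := by
      refine Finset.sum_eq_zero fun ω _ => ?_
      rw [if_neg]
      exact fun h => hb ⟨_, h⟩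
    simp [this]
  · intro a
    classical
    simp only [law_eq_sum_ite, he.eq_iff]

/-- A nonnegative joint weight disintegrates into a marginal and a channel. -/
theorem exists_channel [Nonempty A] (J : A → B → ℝ) (hJ : ∀ a b, 0 ≤ J a b) :
    ∃ c : B → A → ℝ, IsChannel c ∧ ∀ a b, J a b = (∑ a', J a' b) * c b a := by
  classical
  obtain ⟨a₀⟩ := ‹Nonempty A›
  -- Where the marginal vanishes the channel is a point mass at `a₀`, so that it is a channel
  -- everywhere.
  refine ⟨fun b a => if (∑ a', J a' b) = 0 then (if a = a₀ then 1 else 0)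
    else J a b / ∑ a', J a' b, fun b => ?_, fun a b => ?_⟩
  · by_cases h : (∑ a', J a' b) = 0
    · simp only [h, if_true]
      exact ⟨fun a => by positivity, by simp⟩
    · simp only [h, if_false]
      refine ⟨fun a => div_nonneg (hJ a b) (Finset.sum_nonneg fun i _ => hJ i b), ?_⟩
      rw [← Finset.sum_div, div_self h]
  · by_cases h : (∑ a', J a' b) = 0
    · simp only [h, zero_mul]
      exact (Finset.sum_eq_zero_iff_of_nonneg fun i _ => hJ i b).1 h a (Finset.mem_univ a)
    · simp only [h, if_false]
      field_simp

theorem nonempty_of_mem_stdSimplex {P : Ω → ℝ} (hP : P ∈ stdSimplex ℝ Ω) : Nonempty Ω := by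
  by_contra h
  rw [not_nonempty_iff] at h
  have := hP.2
  simp at this

/-- A regular conditional distribution of `f` given `g`. -/
theorem exists_condLaw {P : Ω → ℝ} (hP : P ∈ stdSimplex ℝ Ω) (f : Ω → A) (g : Ω → B) :
    ∃ c : B → A → ℝ, IsChannel c ∧
      ∀ a b, law P (fun ω => (f ω, g ω)) (a, b) = law P g b * c b a := by
  obtain ⟨ω⟩ := nonempty_of_mem_stdSimplex hP
  have : Nonempty A := ⟨f ω⟩
  obtain ⟨c, hc, h⟩ := exists_channel (fun a b => law P (fun ω => (f ω, g ω)) (a, b))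
    (fun a b => law_nonneg hP.1 _ _)
  refine ⟨c, hc, fun a b => ?_⟩
  rw [h a b, sum_law_fst]

/-- By `negMulLog (x * y) = y * negMulLog x + x * negMulLog y` the joint entropy splits into the
entropy of `g` and the average entropy of the rows of `c`. Rows over null values carry weight zero,
so any version of the conditional law may be used. -/
theorem condEntropy_eq_sum {P : Ω → ℝ} {f : Ω → A} {g : Ω → B} {c : B → A → ℝ}
    (hc : IsChannel c)
    (h : ∀ a b, law P (fun ω => (f ω, g ω)) (a, b) = law P g b * c b a) :
    condEntropy P f g = ∑ b, law P g b * hent (c b) := by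
  unfold condEntropy entropy hent
  rw [← sub_div]
  simp only [← mul_div_assoc, ← Finset.sum_div]
  congr 1
  rw [Fintype.sum_prod_type, Finset.sum_comm, ← Finset.sum_sub_distrib]
  refine Finset.sum_congr rfl fun b _ => ?_
  simp only [h, Real.negMulLog_mul, Finset.sum_add_distrib, ← Finset.mul_sum, ← Finset.sum_mul,
    hc.sum_eq_one]
  ring

theorem condEntropy_nonneg {P : Ω → ℝ} (hP : P ∈ stdSimplex ℝ Ω) (f : Ω → A) (g : Ω → B) :
    0 ≤ condEntropy P f g := by
  obtain ⟨c, hc, h⟩ := exists_condLaw hP f g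
  rw [condEntropy_eq_sum hc h]
  exact Finset.sum_nonneg fun b _ => mul_nonneg (law_nonneg hP.1 _ _) (hent_nonneg (hc b))

theorem exists_eq_comp {P : Ω → ℝ} (hP : P ∈ stdSimplex ℝ Ω) {f : Ω → A} {g : Ω → B}
    (h : ∀ ω ω', g ω = g ω' → f ω = f ω') : ∃ φ : B → A, ∀ ω, f ω = φ (g ω) := by
  obtain ⟨ω₀⟩ := nonempty_of_mem_stdSimplex hP
  have hfac : Function.FactorsThrough f g := fun ω ω' e => h ω ω' e
  exact ⟨Function.extend g f fun _ => f ω₀, fun ω => (hfac.extend_apply _ ω).symm⟩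

/-- A random variable determined by another one has at most its entropy. -/
theorem entropy_le_of_determines {P : Ω → ℝ} (hP : P ∈ stdSimplex ℝ Ω) {f : Ω → A} {g : Ω → B}
    (h : ∀ ω ω', g ω = g ω' → f ω = f ω') : entropy P f ≤ entropy P g := by
  obtain ⟨φ, hφ⟩ := exists_eq_comp hP h
  -- Since `g` determines `f`, `H(g) = H(g, f) = H(f) + H(g | f)`.
  have h1 := entropy_injective P g (e := fun b => (b, φ b)) (fun b b' e => (Prod.ext_iff.1 e).1)
  have h2 := condEntropy_nonneg hP g f
  unfold condEntropy at h2
  have h3 : f = fun ω => φ (g ω) := funext hφ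
  rw [h3] at h2 ⊢
  linarith

/-- Entropy sees only the partition of `Ω` into level sets. Regrouping or permuting the components
of a tuple thus becomes a propositional matter about equalities. -/
theorem entropy_congr {P : Ω → ℝ} (hP : P ∈ stdSimplex ℝ Ω) {f : Ω → A} {g : Ω → B}
    (h : ∀ ω ω', f ω = f ω' ↔ g ω = g ω') : entropy P f = entropy P g :=
  le_antisymm (entropy_le_of_determines hP fun ω ω' => (h ω ω').2)
    (entropy_le_of_determines hP fun ω ω' => (h ω ω').1)

theorem condEntropy_congr {P : Ω → ℝ} (hP : P ∈ stdSimplex ℝ Ω) {f : Ω → A} {g : Ω → B}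
    {f' : Ω → C} {g' : Ω → D} (hg : ∀ ω ω', g ω = g ω' ↔ g' ω = g' ω')
    (hf : ∀ ω ω', g ω = g ω' → (f ω = f ω' ↔ f' ω = f' ω')) :
    condEntropy P f g = condEntropy P f' g' := by
  unfold condEntropy
  rw [entropy_congr hP hg, entropy_congr hP (f := fun ω => (f ω, g ω))
    (g := fun ω => (f' ω, g' ω))]
  intro ω ω'
  have h1 := hg ω ω'
  have h2 := hf ω ω'
  simp only [Prod.mk.injEq]
  tauto

/-- The conditional law given `h` is a mixture, over the values of `g`, of the laws given `(g, h)`;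
concavity of the entropy does the rest. -/
theorem condEntropy_pair_le {P : Ω → ℝ} (hP : P ∈ stdSimplex ℝ Ω) (f : Ω → A) (g : Ω → B)
    (h : Ω → C) : condEntropy P f (fun ω => (g ω, h ω)) ≤ condEntropy P f h := by
  obtain ⟨c, hc, hcl⟩ := exists_condLaw hP f (fun ω => (g ω, h ω))
  obtain ⟨d, hd, hdl⟩ := exists_condLaw hP g h
  have hfh : ∀ a z, law P (fun ω => (f ω, h ω)) (a, z) =
      law P h z * ∑ b, d z b * c (b, z) a := by
    intro a z
    have h1 : law P (fun ω => (f ω, h ω)) (a, z) =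
        ∑ b, law P (fun ω => (f ω, (g ω, h ω))) (a, (b, z)) := by
      classical
      simp only [law_eq_sum_ite]
      rw [Finset.sum_comm]
      refine Finset.sum_congr rfl fun ω _ => ?_
      rw [← Finset.mul_sum]
      by_cases h1 : f ω = a <;> by_cases h2 : h ω = z <;> simp [h1, h2, Prod.ext_iff]
    rw [h1, Finset.mul_sum]
    refine Finset.sum_congr rfl fun b _ => ?_
    rw [hcl, hdl]
    ring
  have hcd : IsChannel fun z a => ∑ b, d z b * c (b, z) a := by
    refine fun z => ⟨fun a => Finset.sum_nonneg fun b _ =>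
      mul_nonneg (hd.nonneg _ _) (hc.nonneg _ _), ?_⟩
    rw [Finset.sum_comm]
    simp only [← Finset.mul_sum, hc.sum_eq_one, mul_one, hd.sum_eq_one]
  rw [condEntropy_eq_sum hc hcl, condEntropy_eq_sum hcd hfh, Fintype.sum_prod_type,
    Finset.sum_comm]
  refine Finset.sum_le_sum fun z _ => ?_
  have := sum_mul_hent_le (hd z) (v := fun b => c (b, z)) (fun b a => hc.nonneg _ _)
  calc ∑ b, law P (fun ω => (g ω, h ω)) (b, z) * hent (c (b, z))
      = law P h z * ∑ b, d z b * hent (c (b, z)) := by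
        rw [Finset.mul_sum]
        refine Finset.sum_congr rfl fun b _ => ?_
        rw [hdl]
        ring
    _ ≤ _ := mul_le_mul_of_nonneg_left this (law_nonneg hP.1 _ _)

/-- Conditioning on more reduces entropy. -/
theorem condEntropy_le_of_determines {P : Ω → ℝ} (hP : P ∈ stdSimplex ℝ Ω) (f : Ω → A)
    {g : Ω → B} {h : Ω → C} (hgh : ∀ ω ω', g ω = g ω' → h ω = h ω') :
    condEntropy P f g ≤ condEntropy P f h := by
  refine le_of_eq_of_le (condEntropy_congr hP (fun ω ω' => ?_) fun ω ω' _ => Iff.rfl)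
    (condEntropy_pair_le hP f g h)
  have := hgh ω ω'
  simp only [Prod.mk.injEq]
  tauto

/-- Subadditivity of the conditional entropy of a vector. -/
theorem condEntropy_pi_le {P : Ω → ℝ} (hP : P ∈ stdSimplex ℝ Ω) (g : Ω → B) :
    ∀ {n : ℕ} (f : Fin n → Ω → A),
      condEntropy P (fun ω i => f i ω) g ≤ ∑ i, condEntropy P (f i) g
  | 0, f => by
    have : entropy P (fun ω => ((fun i => f i ω : Fin 0 → A), g ω)) = entropy P g :=
      entropy_congr hP fun ω ω' => by
        simp [Prod.ext_iff, eq_iff_true_of_subsingleton]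
    simp [condEntropy, this]
  | n + 1, f => by
    have h1 := condEntropy_pi_le hP g fun i : Fin n => f i.succ
    have h2 := condEntropy_pair_le hP (f 0) (fun ω (i : Fin n) => f i.succ ω) g
    have h3 : entropy P (fun ω => ((fun i => f i ω), g ω)) =
        entropy P (fun ω => (f 0 ω, ((fun i : Fin n => f i.succ ω), g ω))) :=
      entropy_congr hP fun ω ω' => by
        simp only [Prod.mk.injEq, funext_iff, Fin.forall_fin_succ, and_assoc]
    rw [Fin.sum_univ_succ]
    unfold condEntropy at *
    linarith

theorem entropy_pi_le {P : Ω → ℝ} (hP : P ∈ stdSimplex ℝ Ω) {n : ℕ} (f : Fin n → Ω → A) :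
    entropy P (fun ω i => f i ω) ≤ ∑ i, entropy P (f i) := by
  have key := condEntropy_pi_le hP (fun _ => ()) f
  have h0 : entropy P (fun _ : Ω => ()) = 0 := by
    have : law P (fun _ : Ω => ()) () = 1 := by simp [law, prob, hP.2]
    simp [entropy, this]
  have hdrop : ∀ {E : Type _} [Fintype E] (e : Ω → E),
      condEntropy P e (fun _ => ()) = entropy P e := fun e => by
    rw [condEntropy, h0, sub_zero]
    exact entropy_congr hP fun ω ω' => by simp
  rw [condEntropy, h0, sub_zero] at key
  refine le_trans (le_of_eq ?_) (key.trans (le_of_eq (Finset.sum_congr rfl fun i _ => hdrop (f i))))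
  exact entropy_congr hP fun ω ω' => by simp

theorem condEntropy_le_entropy {P : Ω → ℝ} (hP : P ∈ stdSimplex ℝ Ω) (f : Ω → A) (g : Ω → B) :
    condEntropy P f g ≤ entropy P f := by
  have h := condEntropy_le_of_determines hP f (g := g) (h := fun _ => ()) fun _ _ _ => rfl
  have h0 : entropy P (fun _ : Ω => ()) = 0 := by
    have : law P (fun _ : Ω => ()) () = 1 := by simp [law, prob, hP.2]
    simp [entropy, this]
  have h1 : entropy P (fun ω => (f ω, ())) = entropy P f :=
    entropy_congr hP fun ω ω' => by simp
  unfold condEntropy at *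
  linarith

/-! ### Product distributions. -/

section Product

variable {n : ℕ}

theorem sum_prod_mul_apply (v : Fin n → A → ℝ) (hv : ∀ i, ∑ a, v i a = 1) (q : Fin n)
    (φ : A → ℝ) : ∑ y : Fin n → A, (∏ i, v i (y i)) * φ (y q) = ∑ a, v q a * φ a := by
  classical
  have h := Finset.prod_univ_sum (fun _ : Fin n => (Finset.univ : Finset A))
    (fun i a => v i a * if i = q then φ a else 1)
  rw [Fintype.piFinset_univ] at h
  have h1 : ∀ y : Fin n → A, ∏ i, (v i (y i) * if i = q then φ (y i) else 1) =
      (∏ i, v i (y i)) * φ (y q) := fun y => by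
    rw [Finset.prod_mul_distrib, Finset.prod_ite_eq' Finset.univ q]
    simp
  simp only [h1] at h
  rw [← h, Finset.prod_eq_single q]
  · simp
  · intro i _ hi
    simp [hi, hv]
  · simp

theorem sum_prod_eq_one (v : Fin n → A → ℝ) (hv : ∀ i, ∑ a, v i a = 1) :
    ∑ y : Fin n → A, ∏ i, v i (y i) = 1 := by
  classical
  have h := Finset.prod_univ_sum (fun _ : Fin n => (Finset.univ : Finset A)) v
  rw [Fintype.piFinset_univ] at h
  rw [← h]
  simp [hv]

theorem prod_mem_stdSimplex {v : Fin n → A → ℝ} (hv : ∀ i, v i ∈ stdSimplex ℝ A) :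
    (fun y : Fin n → A => ∏ i, v i (y i)) ∈ stdSimplex ℝ (Fin n → A) :=
  ⟨fun _ => Finset.prod_nonneg fun i _ => (hv i).1 _, sum_prod_eq_one v fun i => (hv i).2⟩

/-- The entropy of a product distribution. -/
theorem hent_prod (v : Fin n → A → ℝ) (hv : ∀ i, ∑ a, v i a = 1) :
    hent (fun y : Fin n → A => ∏ i, v i (y i)) = ∑ i, hent (v i) := by
  simp only [hent, ← Finset.sum_div]
  congr 1
  have h1 : ∀ y : Fin n → A, Real.negMulLog (∏ i, v i (y i)) =
      ∑ q, (∏ i, v i (y i)) * -Real.log (v q (y q)) := fun y => by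
    by_cases h : ∃ i, v i (y i) = 0
    · obtain ⟨i, hi⟩ := h
      have : ∏ i, v i (y i) = 0 := Finset.prod_eq_zero (Finset.mem_univ i) hi
      simp [this]
    · push Not at h
      rw [Real.negMulLog, Real.log_prod (fun i _ => h i), ← Finset.mul_sum,
        Finset.sum_neg_distrib]
      ring
  simp only [h1]
  rw [Finset.sum_comm]
  refine Finset.sum_congr rfl fun q _ => ?_
  rw [sum_prod_mul_apply v hv q fun a => -Real.log (v q a)]
  exact Finset.sum_congr rfl fun a _ => by simp [Real.negMulLog]

/-- The law of letterwise functions under a product distribution. -/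
theorem law_prod (v : Fin n → A → ℝ) (φ : Fin n → A → B) (b : Fin n → B) :
    law (fun y : Fin n → A => ∏ i, v i (y i)) (fun y i => φ i (y i)) b =
      ∏ i, law (v i) (φ i) (b i) := by
  classical
  simp only [law_eq_sum_ite]
  have h := Finset.prod_univ_sum (fun _ : Fin n => (Finset.univ : Finset A))
    (fun i a => v i a * if φ i a = b i then 1 else 0)
  rw [Fintype.piFinset_univ] at h
  rw [h]
  refine Finset.sum_congr rfl fun y _ => ?_
  rw [Finset.prod_mul_distrib, Finset.prod_ite_zero]
  simp [funext_iff]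

theorem entropy_prod {v : A → ℝ} (hv : v ∈ stdSimplex ℝ A) (φ : A → B) :
    entropy (fun y : Fin n → A => ∏ i, v (y i)) (fun y i => φ (y i)) = n * entropy v φ := by
  rw [entropy_eq_hent, entropy_eq_hent]
  have : law (fun y : Fin n → A => ∏ i, v (y i)) (fun y i => φ (y i)) =
      fun b => ∏ i, law v φ (b i) := funext fun b => law_prod (fun _ => v) (fun _ => φ) b
  rw [this, hent_prod (fun _ => law v φ) fun _ => (law_mem_stdSimplex hv φ).2]
  simp

end Product

end Entropy

/-! ### Carathéodory's theorem and compactness of convex hulls. -/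

section ConvexHull

variable {E : Type*} [AddCommGroup E] [Module ℝ E] [FiniteDimensional ℝ E]

/-- Carathéodory's theorem with a fixed number of points. -/
theorem exists_convexCombination_of_mem_convexHull {s : Set E} {x : E}
    (hx : x ∈ convexHull ℝ s) :
    ∃ w ∈ stdSimplex ℝ (Fin (Module.finrank ℝ E + 1)),
      ∃ z : Fin (Module.finrank ℝ E + 1) → E, (∀ i, z i ∈ s) ∧ ∑ i, w i • z i = x := by
  classical
  obtain ⟨s₀, hs₀⟩ := convexHull_nonempty_iff.1 ⟨x, hx⟩
  obtain ⟨ι, _, z, w, hz, hi, hw, hw1, hx⟩ := eq_pos_convex_span_of_mem_convexHull hx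
  have hcard : Fintype.card ι ≤ Fintype.card (Fin (Module.finrank ℝ E + 1)) := by
    rw [Fintype.card_fin]
    exact hi.card_le_finrank_succ.trans (Nat.succ_le_succ (Submodule.finrank_le _))
  obtain ⟨e⟩ := Function.Embedding.nonempty_of_card_le hcard
  -- The affinely independent points are padded to the fixed number `finrank + 1` by copies of `s₀`
  -- with weight zero.
  refine ⟨Function.extend e w 0, ⟨fun i => ?_, ?_⟩, Function.extend e z fun _ => s₀, fun i => ?_, ?_⟩
  · by_cases h : ∃ j, e j = i
    · obtain ⟨j, rfl⟩ := h
      rw [e.injective.extend_apply]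
      exact (hw j).le
    · rw [Function.extend_apply' _ _ _ h]
      rfl
  · rw [← hw1]
    symm
    refine Fintype.sum_of_injective e e.injective _ _ (fun i h => ?_) fun j => ?_
    · rw [Function.extend_apply' _ _ _ h]
      rfl
    · rw [e.injective.extend_apply]
  · by_cases h : ∃ j, e j = i
    · obtain ⟨j, rfl⟩ := h
      rw [e.injective.extend_apply]
      exact hz ⟨j, rfl⟩
    · rw [Function.extend_apply' _ _ _ h]
      exact hs₀
  · rw [← hx]
    symm
    refine Fintype.sum_of_injective e e.injective _ _ (fun i h => ?_) fun j => ?_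
    · rw [Function.extend_apply' _ _ _ h]
      exact zero_smul _ _
    · rw [e.injective.extend_apply, e.injective.extend_apply]

theorem convexCombination_mem_convexHull {s : Set E} {ι : Type*} [Fintype ι] {w : ι → ℝ}
    (hw : w ∈ stdSimplex ℝ ι) {z : ι → E} (hz : ∀ i, z i ∈ s) :
    ∑ i, w i • z i ∈ convexHull ℝ s :=
  (convex_convexHull ℝ s).sum_mem (fun i _ => hw.1 i) hw.2 fun i _ =>
    subset_convexHull ℝ s (hz i)

/-- With the number of points fixed, the hull is the continuous image of a simplex times a power of
`s`. -/
theorem isCompact_convexHull_of_finiteDimensional [TopologicalSpace E] [ContinuousAdd E]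
    [ContinuousSMul ℝ E] {s : Set E} (hs : IsCompact s) : IsCompact (convexHull ℝ s) := by
  have himg : convexHull ℝ s =
      (fun p : (Fin (Module.finrank ℝ E + 1) → ℝ) × (Fin (Module.finrank ℝ E + 1) → E) =>
        ∑ i, p.1 i • p.2 i) '' (stdSimplex ℝ _ ×ˢ Set.univ.pi fun _ => s) := by
    ext x
    constructor
    · intro hx
      obtain ⟨w, hw, z, hz, h⟩ := exists_convexCombination_of_mem_convexHull hx
      exact ⟨(w, z), ⟨hw, fun i _ => hz i⟩, h⟩
    · rintro ⟨⟨w, z⟩, ⟨hw, hz⟩, rfl⟩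
      exact convexCombination_mem_convexHull hw fun i => hz i (Set.mem_univ i)
  rw [himg]
  refine IsCompact.image ((isCompact_stdSimplex ℝ _).prod (isCompact_univ_pi fun _ => hs)) ?_
  fun_prop

end ConvexHull

/-! ### Compact sets of achievable conditional output entropies. -/

section Hulls

variable {X : Type*} [Fintype X]

/-- The convex hull of the graph of `h` over the simplex. Its points are the averages
of `(v, h v)` over a finitely supported distribution of `v`. -/
def graphHull (h : (X → ℝ) → ℝ × ℝ) : Set ((X → ℝ) × ℝ × ℝ) :=
  convexHull ℝ ((fun v => (v, h v)) '' stdSimplex ℝ X)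

/-- The points over an input distribution `v` that carry the value `h v` and two refinements
of `v` into a mixture. -/
def refinements (h : (X → ℝ) → ℝ × ℝ) : Set ((X → ℝ) × (ℝ × ℝ) × (ℝ × ℝ) × (ℝ × ℝ)) :=
  {d | d.1 ∈ stdSimplex ℝ X ∧ d.2.1 = h d.1 ∧ (d.1, d.2.2.1) ∈ graphHull h ∧
    (d.1, d.2.2.2) ∈ graphHull h}

/-- Mixtures of points of `refinements h`. -/
def layeredHull (h : (X → ℝ) → ℝ × ℝ) : Set ((X → ℝ) × (ℝ × ℝ) × (ℝ × ℝ) × (ℝ × ℝ)) :=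
  convexHull ℝ (refinements h)

theorem isCompact_graphHull {h : (X → ℝ) → ℝ × ℝ} (hh : Continuous h) :
    IsCompact (graphHull h) :=
  isCompact_convexHull_of_finiteDimensional
    ((isCompact_stdSimplex ℝ X).image (continuous_id.prodMk hh))

/-- The set `refinements h` is cut out by closed conditions inside a product of compact sets.
Compactness gives limits of the single-letter data without control of auxiliary alphabets. -/
theorem isCompact_layeredHull {h : (X → ℝ) → ℝ × ℝ} (hh : Continuous h) :
    IsCompact (layeredHull h) := by
  refine isCompact_convexHull_of_finiteDimensional ?_
  have hG := isCompact_graphHull hh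
  have hK : IsCompact (stdSimplex ℝ X ×ˢ (h '' stdSimplex ℝ X) ×ˢ
      (Prod.snd '' graphHull h) ×ˢ (Prod.snd '' graphHull h)) :=
    (isCompact_stdSimplex ℝ X).prod (((isCompact_stdSimplex ℝ X).image hh).prod
      ((hG.image continuous_snd).prod (hG.image continuous_snd)))
  refine hK.of_isClosed_subset ?_ ?_
  · refine ((isCompact_stdSimplex ℝ X).isClosed.preimage continuous_fst).inter ?_
    refine (isClosed_eq (by fun_prop) (by fun_prop)).inter ?_
    exact (hG.isClosed.preimage (by fun_prop : Continuous fun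
        d : (X → ℝ) × (ℝ × ℝ) × (ℝ × ℝ) × (ℝ × ℝ) => (d.1, d.2.2.1))).inter
      (hG.isClosed.preimage (by fun_prop : Continuous fun
        d : (X → ℝ) × (ℝ × ℝ) × (ℝ × ℝ) × (ℝ × ℝ) => (d.1, d.2.2.2)))
  · rintro ⟨v, c, a, b⟩ ⟨h1, h2, h3, h4⟩
    exact ⟨h1, ⟨v, h1, h2.symm⟩, ⟨_, h3, rfl⟩, ⟨_, h4, rfl⟩⟩

theorem mem_graphHull_self {h : (X → ℝ) → ℝ × ℝ} {v : X → ℝ} (hv : v ∈ stdSimplex ℝ X) :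
    (v, h v) ∈ graphHull h :=
  subset_convexHull ℝ _ ⟨v, hv, rfl⟩

theorem mem_layeredHull_self {h : (X → ℝ) → ℝ × ℝ} {v : X → ℝ} (hv : v ∈ stdSimplex ℝ X) :
    (v, h v, h v, h v) ∈ layeredHull h :=
  subset_convexHull ℝ _ ⟨hv, rfl, mem_graphHull_self hv, mem_graphHull_self hv⟩

theorem exists_of_mem_graphHull {h : (X → ℝ) → ℝ × ℝ} {v : X → ℝ} {a : ℝ × ℝ}
    (hva : (v, a) ∈ graphHull h) :
    ∃ w ∈ stdSimplex ℝ (Fin (Module.finrank ℝ ((X → ℝ) × ℝ × ℝ) + 1)),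
      ∃ π : Fin (Module.finrank ℝ ((X → ℝ) × ℝ × ℝ) + 1) → X → ℝ,
        (∀ i, π i ∈ stdSimplex ℝ X) ∧ (∀ x, ∑ i, w i * π i x = v x) ∧
          ∑ i, w i • h (π i) = a := by
  obtain ⟨w, hw, z, hz, hs⟩ := exists_convexCombination_of_mem_convexHull hva
  choose π hπ hz using hz
  refine ⟨w, hw, π, hπ, fun x => ?_, ?_⟩
  · have := congrFun (congrArg Prod.fst hs) x
    simpa [Prod.fst_sum, ← hz] using this
  · have := congrArg Prod.snd hs
    simpa [Prod.snd_sum, ← hz] using this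

end Hulls

/-! ### Channel outputs given side information. -/

section Markov

variable {Ω A B C D X : Type*} [Fintype Ω] [Fintype A] [Fintype B] [Fintype C] [Fintype D]
  [Fintype X]

/-- The output distribution of the channel `c` for the input distribution `v`. -/
def outLaw (c : X → B → ℝ) (v : X → ℝ) (b : B) : ℝ := ∑ x, v x * c x b

open Classical in
/-- Given `T`, the variable `f` is the output of the channel `c` for the input `ξ`. -/
def IsOutputGiven (P : Ω → ℝ) (c : X → B → ℝ) (ξ : Ω → X) (f : Ω → B) (T : Ω → C) : Prop :=
  ∀ b (Φ : C → ℝ), ∑ ω, P ω * ((if f ω = b then 1 else 0) * Φ (T ω)) =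
    ∑ ω, P ω * (c (ξ ω) b * Φ (T ω))

theorem IsOutputGiven.comp {P : Ω → ℝ} {c : X → B → ℝ} {ξ : Ω → X} {f : Ω → B} {T : Ω → C}
    (h : IsOutputGiven P c ξ f T) (φ : C → D) : IsOutputGiven P c ξ f (fun ω => φ (T ω)) :=
  fun b Φ => h b fun t => Φ (φ t)

theorem outLaw_mem_stdSimplex {c : X → B → ℝ} (hc : IsChannel c) {v : X → ℝ}
    (hv : v ∈ stdSimplex ℝ X) : outLaw c v ∈ stdSimplex ℝ B := by
  refine ⟨fun b => Finset.sum_nonneg fun x _ => mul_nonneg (hv.1 x) (hc.nonneg x b), ?_⟩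
  unfold outLaw
  rw [Finset.sum_comm]
  simp only [← Finset.mul_sum, hc.sum_eq_one, mul_one, hv.2]

theorem IsOutputGiven.law_eq {P : Ω → ℝ} {c : X → B → ℝ} {ξ : Ω → X} {f : Ω → B} {T : Ω → C}
    (h : IsOutputGiven P c ξ f T) : law P f = outLaw c (law P ξ) := by
  classical
  ext b
  have := h b fun _ => 1
  rw [outLaw, sum_law_mul P ξ fun x => c x b, law_eq_sum_ite]
  simpa using this

theorem IsOutputGiven.law_pair_eq {P : Ω → ℝ} {c : X → B → ℝ} {ξ : Ω → X} {f : Ω → B}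
    {T : Ω → C} (h : IsOutputGiven P c ξ f T) (b : B) (t : C) :
    law P (fun ω => (f ω, T ω)) (b, t) =
      ∑ x, law P (fun ω => (ξ ω, T ω)) (x, t) * c x b := by
  classical
  have h1 := h b fun t' => if t' = t then 1 else 0
  have h2 := sum_law_mul P (fun ω => (ξ ω, T ω)) fun p => c p.1 b * if p.2 = t then 1 else 0
  rw [← h2, Fintype.sum_prod_type] at h1
  rw [law_eq_sum_ite]
  refine Eq.trans (Finset.sum_congr rfl fun ω _ => ?_) (h1.trans ?_)
  · by_cases h1 : f ω = b <;> by_cases h2 : T ω = t <;> simp [h1, h2]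
  · simp

/-- Given `T = t`, the output law is the image under `c` of the conditional input law `d t`. The
conditional entropy therefore remembers of `T` only the distribution of these input laws. -/
theorem IsOutputGiven.condEntropy_eq {P : Ω → ℝ} {c : X → B → ℝ} (hc : IsChannel c)
    {ξ : Ω → X} {f : Ω → B} {T : Ω → C} (h : IsOutputGiven P c ξ f T) {d : C → X → ℝ}
    (hd : IsChannel d)
    (hdl : ∀ x t, law P (fun ω => (ξ ω, T ω)) (x, t) = law P T t * d t x) :
    condEntropy P f T = ∑ t, law P T t * hent (outLaw c (d t)) := by
  refine condEntropy_eq_sum (fun t => outLaw_mem_stdSimplex hc (hd t)) fun b t => ?_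
  rw [h.law_pair_eq, outLaw, Finset.mul_sum]
  simp only [hdl, mul_assoc]

theorem IsOutputGiven.condEntropy_mixture {P : Ω → ℝ} {c : X → B → ℝ} {ξ : Ω → X}
    {f : Ω → B} {T : Ω → C} (h : IsOutputGiven P c ξ f T) (hc : IsChannel c) {l : C → ℝ}
    {d : C → X → ℝ} (hd : ∀ t, d t ∈ stdSimplex ℝ X)
    (hdl : ∀ x t, law P (fun ω => (ξ ω, T ω)) (x, t) = l t * d t x) :
    condEntropy P f T = ∑ t, l t * hent (outLaw c (d t)) := by
  have hl : ∀ t, law P T t = l t := fun t => by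
    rw [← sum_law_fst P ξ T]
    simp only [hdl, ← Finset.mul_sum, (hd _).2, mul_one]
  simp only [← hl] at hdl ⊢
  exact h.condEntropy_eq hc hd hdl

/-- Given the input as well, the output has the entropy of the channel. -/
theorem IsOutputGiven.condEntropy_input_eq {P : Ω → ℝ} {c : X → B → ℝ} (hc : IsChannel c)
    {ξ : Ω → X} {f : Ω → B} {T : Ω → C} (h : IsOutputGiven P c ξ f fun ω => (T ω, ξ ω)) :
    condEntropy P f (fun ω => (T ω, ξ ω)) = ∑ x, law P ξ x * hent (c x) := by
  classical
  rw [condEntropy_eq_sum (c := fun t => c t.2) (fun t => hc t.2) fun b t => ?_,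
    sum_law_mul P (fun ω => (T ω, ξ ω)) fun t => hent (c t.2), sum_law_mul]
  have h1 := h b fun t' => if t' = t then 1 else 0
  rw [law_eq_sum_ite, law_eq_sum_ite, Finset.sum_mul]
  refine Eq.trans (Finset.sum_congr rfl fun ω _ => ?_) (h1.trans ?_)
  · by_cases h1 : f ω = b <;> by_cases h2 : (T ω, ξ ω) = t <;> simp [h1, h2]
  · refine Finset.sum_congr rfl fun ω _ => ?_
    by_cases h2 : (T ω, ξ ω) = t
    · subst h2
      simp
    · simp [h2]

theorem mutualInfo_eq {P : Ω → ℝ} (hP : P ∈ stdSimplex ℝ Ω) (f : Ω → A) (g : Ω → B) :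
    mutualInfo P f g = entropy P g - condEntropy P g f := by
  have : entropy P (fun ω => (f ω, g ω)) = entropy P (fun ω => (g ω, f ω)) :=
    entropy_congr hP fun ω ω' => by simp only [Prod.mk.injEq]; tauto
  unfold mutualInfo condEntropy
  linarith

theorem condMutualInfo_eq {P : Ω → ℝ} (hP : P ∈ stdSimplex ℝ Ω) (f : Ω → A) (g : Ω → B)
    (h : Ω → C) :
    condMutualInfo P f g h = condEntropy P g h - condEntropy P g (fun ω => (h ω, f ω)) := by
  have h1 : entropy P (fun ω => (f ω, h ω)) = entropy P (fun ω => (h ω, f ω)) :=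
    entropy_congr hP fun ω ω' => by simp only [Prod.mk.injEq]; tauto
  have h2 : entropy P (fun ω => (f ω, (g ω, h ω))) = entropy P (fun ω => (g ω, (h ω, f ω))) :=
    entropy_congr hP fun ω ω' => by simp only [Prod.mk.injEq]; tauto
  unfold condMutualInfo condEntropy
  linarith

end Markov

/-! ### Marginal channels and their output entropies. -/

section Channel

variable {X Y₁ Y₂ : Type*} [Fintype X] [Fintype Y₁] [Fintype Y₂]

/-- The channel to the first receiver. -/
def marginal₁ (W : X → Y₁ × Y₂ → ℝ) (x : X) (y : Y₁) : ℝ := ∑ y', W x (y, y')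

/-- The channel to the second receiver. -/
def marginal₂ (W : X → Y₁ × Y₂ → ℝ) (x : X) (y : Y₂) : ℝ := ∑ y', W x (y', y)

theorem isChannel_marginal₁ {W : X → Y₁ × Y₂ → ℝ} (hW : IsChannel W) :
    IsChannel (marginal₁ W) := fun x =>
  ⟨fun _ => Finset.sum_nonneg fun _ _ => hW.nonneg x _, by
    simpa [marginal₁, Fintype.sum_prod_type] using hW.sum_eq_one x⟩

theorem isChannel_marginal₂ {W : X → Y₁ × Y₂ → ℝ} (hW : IsChannel W) :
    IsChannel (marginal₂ W) := fun x =>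
  ⟨fun _ => Finset.sum_nonneg fun _ _ => hW.nonneg x _, by
    simpa [marginal₂, Fintype.sum_prod_type_right] using hW.sum_eq_one x⟩

/-- The entropies of the two outputs for an input distribution. -/
def outputEntropies (W : X → Y₁ × Y₂ → ℝ) (v : X → ℝ) : ℝ × ℝ :=
  (hent (outLaw (marginal₁ W) v), hent (outLaw (marginal₂ W) v))

/-- The conditional entropy of the output given the input. -/
def noiseEntropy {B : Type*} [Fintype B] (c : X → B → ℝ) (v : X → ℝ) : ℝ :=
  ∑ x, v x * hent (c x)

theorem continuous_outputEntropies (W : X → Y₁ × Y₂ → ℝ) : Continuous (outputEntropies W) := by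
  unfold outputEntropies hent outLaw
  refine Continuous.prodMk ?_ ?_ <;> refine Continuous.div_const ?_ _ <;>
    exact continuous_finsetSum _ fun b _ => Real.continuous_negMulLog.comp (by fun_prop)

theorem noiseEntropy_le {B : Type*} [Fintype B] {c : X → B → ℝ} (hc : IsChannel c) {v : X → ℝ}
    (hv : v ∈ stdSimplex ℝ X) : noiseEntropy c v ≤ hent (outLaw c v) :=
  sum_mul_hent_le hv fun x b => hc.nonneg x b

end Channel

/-! ### Realising hull points by auxiliary variables. -/

section ChannelJoint

variable {X Y₁ Y₂ V : Type*} [Fintype X] [Fintype Y₁] [Fintype Y₂] [Fintype V]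

theorem channelJoint_mem_stdSimplex {Y : Type*} [Fintype Y] {K : X → V → ℝ} (hK : IsChannel K)
    {pX : X → ℝ} (hpX : pX ∈ stdSimplex ℝ X) {W : X → Y → ℝ} (hW : IsChannel W) :
    channelJoint K pX W ∈ stdSimplex ℝ (V × X × Y) := by
  refine ⟨fun ω => mul_nonneg (mul_nonneg (hK.nonneg _ _) (hpX.1 _)) (hW.nonneg _ _), ?_⟩
  simp only [channelJoint, Fintype.sum_prod_type]
  simp only [← Finset.mul_sum, hW.sum_eq_one, mul_one]
  rw [Finset.sum_comm]
  simp only [← Finset.sum_mul, hK.sum_eq_one, one_mul, hpX.2]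

theorem sum_channelJoint_mul {Y : Type*} [Fintype Y] {K : X → V → ℝ}
    {pX : X → ℝ} {W : X → Y → ℝ} (hW : IsChannel W) (φ : V → X → ℝ) :
    ∑ ω, channelJoint K pX W ω * φ ω.1 ω.2.1 = ∑ v, ∑ x, K x v * pX x * φ v x := by
  simp only [channelJoint, Fintype.sum_prod_type]
  refine Finset.sum_congr rfl fun v _ => Finset.sum_congr rfl fun x _ => ?_
  rw [← Finset.sum_mul, ← Finset.mul_sum, hW.sum_eq_one, mul_one]

theorem isOutputGiven_channelJoint₁ (K : X → V → ℝ) (pX : X → ℝ) {W : X → Y₁ × Y₂ → ℝ}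
    (hW : IsChannel W) :
    IsOutputGiven (channelJoint K pX W) (marginal₁ W) (fun ω => ω.2.1) (fun ω => ω.2.2.1)
      (fun ω => (ω.1, ω.2.1)) := by
  classical
  intro b Φ
  rw [sum_channelJoint_mul hW fun v x => marginal₁ W x b * Φ (v, x)]
  simp only [channelJoint, Fintype.sum_prod_type, marginal₁]
  refine Finset.sum_congr rfl fun v _ => Finset.sum_congr rfl fun x _ => ?_
  rw [Finset.sum_eq_single b]
  · simp only [if_true, one_mul, Finset.sum_mul, Finset.mul_sum]
    exact Finset.sum_congr rfl fun y _ => by ring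
  · intro y _ hy
    simp [hy]
  · simp

theorem isOutputGiven_channelJoint₂ (K : X → V → ℝ) (pX : X → ℝ) {W : X → Y₁ × Y₂ → ℝ}
    (hW : IsChannel W) :
    IsOutputGiven (channelJoint K pX W) (marginal₂ W) (fun ω => ω.2.1) (fun ω => ω.2.2.2)
      (fun ω => (ω.1, ω.2.1)) := by
  classical
  intro b Φ
  rw [sum_channelJoint_mul hW fun v x => marginal₂ W x b * Φ (v, x)]
  simp only [channelJoint, Fintype.sum_prod_type, marginal₂]
  refine Finset.sum_congr rfl fun v _ => Finset.sum_congr rfl fun x _ => ?_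
  rw [Finset.sum_comm, Finset.sum_eq_single b]
  · simp only [if_true, one_mul, Finset.sum_mul, Finset.mul_sum]
    exact Finset.sum_congr rfl fun y _ => by ring
  · intro y _ hy
    simp [hy]
  · simp

theorem law_channelJoint {Y C : Type*} [Fintype Y] [Fintype C] [DecidableEq C] {K : X → V → ℝ}
    {pX : X → ℝ} {W : X → Y → ℝ} (hW : IsChannel W) (τ : V → X → C) (t : C) :
    law (channelJoint K pX W) (fun ω => τ ω.1 ω.2.1) t =
      ∑ v, ∑ x, K x v * pX x * if τ v x = t then 1 else 0 := by
  rw [law_eq_sum_ite, sum_channelJoint_mul hW fun v x => if τ v x = t then 1 else 0]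

end ChannelJoint

/-- The bounds of the outer region at a point of the layered hull: the input distribution, the
output entropies given `V₀`, given `(V₀, V₁)`, and given `(V₀, V₂)`. -/
def SatisfiesOuterBounds {X Y₁ Y₂ : Type*} [Fintype X] [Fintype Y₁] [Fintype Y₂]
    (W : X → Y₁ × Y₂ → ℝ) (e : (X → ℝ) × (ℝ × ℝ) × (ℝ × ℝ) × (ℝ × ℝ)) (R : ℝ × ℝ × ℝ) : Prop :=
  let h := outputEntropies W e.1
  let I := min (h.1 - e.2.1.1) (h.2 - e.2.1.2)
  R.1 ≤ I ∧
  R.1 + R.2.1 ≤ I + (e.2.1.1 - e.2.2.1.1) ∧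
  R.1 + R.2.2 ≤ I + (e.2.1.2 - e.2.2.2.2) ∧
  R.1 + R.2.1 + R.2.2 ≤
    I + (e.2.1.1 - e.2.2.1.1) + (e.2.2.1.2 - noiseEntropy (marginal₂ W) e.1) ∧
  R.1 + R.2.1 + R.2.2 ≤
    I + (e.2.1.2 - e.2.2.2.2) + (e.2.2.2.1 - noiseEntropy (marginal₁ W) e.1)

/-- The index of the outer mixture is `V₀`, and the indices of the two refinements are `V₁` and
`V₂`. Bayes' rule turns the mixtures into channels from the input. The bounds involve only the laws
of `(X, V₀, V₁)` and `(X, V₀, V₂)`, so the coupling of `V₁` with `V₂` is free. -/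
theorem mem_outerRegion_of_satisfiesOuterBounds {X Y₁ Y₂ : Type*} [Fintype X] [Fintype Y₁]
    [Fintype Y₂] {W : X → Y₁ × Y₂ → ℝ} (hW : IsChannel W)
    {e : (X → ℝ) × (ℝ × ℝ) × (ℝ × ℝ) × (ℝ × ℝ)} (he : e ∈ layeredHull (outputEntropies W))
    (hX : e.1 ∈ stdSimplex ℝ X)
    {R : ℝ × ℝ × ℝ} (h0 : 0 ≤ R.1) (h1 : 0 ≤ R.2.1) (h2 : 0 ≤ R.2.2)
    (hR : SatisfiesOuterBounds W e R) : R ∈ outerRegion e.1 W := by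
  classical
  obtain ⟨l, hl, z, hz, hze⟩ := exists_convexCombination_of_mem_convexHull he
  choose α hα π hπ hπs hπh using fun i => exists_of_mem_graphHull (hz i).2.2.1
  choose β hβ ρ hρ hρs hρh using fun i => exists_of_mem_graphHull (hz i).2.2.2
  obtain ⟨κ₀, hκ₀, hκ₀l⟩ := exists_channel (fun i x => l i * (z i).1 x)
    fun i x => mul_nonneg (hl.1 i) ((hz i).1.1 x)
  choose κ₁ hκ₁ hκ₁l using fun i => exists_channel (fun j x => α i j * π i j x)
    fun j x => mul_nonneg ((hα i).1 j) ((hπ i j).1 x)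
  choose κ₂ hκ₂ hκ₂l using fun i => exists_channel (fun j x => β i j * ρ i j x)
    fun j x => mul_nonneg ((hβ i).1 j) ((hρ i j).1 x)
  simp only [hπs] at hκ₁l
  simp only [hρs] at hκ₂l
  have hpX : ∀ x, ∑ i, l i * (z i).1 x = e.1 x := fun x => by
    have := congrFun (congrArg Prod.fst hze) x
    simpa [Prod.fst_sum] using this
  simp only [hpX] at hκ₀l
  -- `V₁` and `V₂` are taken conditionally independent given `(X, V₀)`.
  have hK : IsChannel fun (x : X) (v : Fin (Module.finrank ℝ
      ((X → ℝ) × (ℝ × ℝ) × (ℝ × ℝ) × (ℝ × ℝ)) + 1) ×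
      Fin (Module.finrank ℝ ((X → ℝ) × ℝ × ℝ) + 1) ×
      Fin (Module.finrank ℝ ((X → ℝ) × ℝ × ℝ) + 1)) =>
        κ₀ x v.1 * κ₁ v.1 x v.2.1 * κ₂ v.1 x v.2.2 := by
    refine fun x => ⟨fun v => mul_nonneg (mul_nonneg (hκ₀.nonneg _ _) ((hκ₁ _).nonneg _ _))
      ((hκ₂ _).nonneg _ _), ?_⟩
    simp only [Fintype.sum_prod_type, ← Finset.mul_sum, (hκ₂ _).sum_eq_one,
      (hκ₁ _).sum_eq_one, mul_one, hκ₀.sum_eq_one]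
  refine ⟨h0, h1, h2, _, _, _, _, hK, ?_⟩
  intro Ω P V₀ V₁ V₂ V₀₁ V₀₂ X' B₁ B₂
  have hP : P ∈ stdSimplex ℝ Ω := channelJoint_mem_stdSimplex hK hX hW
  have ho₁ : IsOutputGiven P (marginal₁ W) X' B₁ fun ω => (ω.1, ω.2.1) :=
    isOutputGiven_channelJoint₁ _ _ hW
  have ho₂ : IsOutputGiven P (marginal₂ W) X' B₂ fun ω => (ω.1, ω.2.1) :=
    isOutputGiven_channelJoint₂ _ _ hW
  have hlX : law P X' = e.1 := by
    ext x
    rw [law_channelJoint hW (fun _ x' => x') x, Finset.sum_comm]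
    simp only [← Finset.sum_mul, hK.sum_eq_one, one_mul]
    simp
  have hl₀ : ∀ x i, law P (fun ω => (X' ω, V₀ ω)) (x, i) = l i * (z i).1 x := fun x i => by
    refine (law_channelJoint (V := Fin _ × Fin _ × Fin _) hW (fun v x' => (x', v.1)) (x, i)).trans ?_
    rw [hκ₀l]
    simp only [Fintype.sum_prod_type, Prod.mk.injEq]
    rw [Finset.sum_eq_single i (by intro j _ hj; simp [hj]) (by simp)]
    simp only [and_true, mul_ite, mul_one, mul_zero, Finset.sum_ite_eq', Finset.mem_univ, if_true,
      ← Finset.sum_mul, ← Finset.mul_sum, (hκ₂ _).sum_eq_one, (hκ₁ _).sum_eq_one]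
    ring
  have hl₁ : ∀ x i j, law P (fun ω => (X' ω, V₀₁ ω)) (x, (i, j)) =
      l i * α i j * π i j x := fun x i j => by
    refine (law_channelJoint (V := Fin _ × Fin _ × Fin _) hW (fun v x' => (x', (v.1, v.2.1))) (x, (i, j))).trans ?_
    rw [mul_assoc, hκ₁l, ← mul_assoc, hκ₀l]
    simp only [Fintype.sum_prod_type, Prod.mk.injEq]
    rw [Finset.sum_eq_single i (by intro j _ hj; simp [hj]) (by simp),
      Finset.sum_eq_single j (by intro j _ hj; simp [hj]) (by simp)]
    simp only [and_true, mul_ite, mul_one, mul_zero, Finset.sum_ite_eq', Finset.mem_univ, if_true,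
      ← Finset.sum_mul, ← Finset.mul_sum, (hκ₂ _).sum_eq_one]
    ring
  have hl₂ : ∀ x i j, law P (fun ω => (X' ω, V₀₂ ω)) (x, (i, j)) =
      l i * β i j * ρ i j x := fun x i j => by
    refine (law_channelJoint (V := Fin _ × Fin _ × Fin _) hW (fun v x' => (x', (v.1, v.2.2))) (x, (i, j))).trans ?_
    rw [mul_assoc, hκ₂l, ← mul_assoc, hκ₀l]
    simp only [Fintype.sum_prod_type, Prod.mk.injEq]
    rw [Finset.sum_eq_single i (by intro j _ hj; simp [hj]) (by simp), Finset.sum_comm,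
      Finset.sum_eq_single j (by intro j _ hj; simp [hj]) (by simp)]
    simp only [and_true, mul_ite, mul_one, mul_zero, Finset.sum_ite_eq', Finset.mem_univ, if_true,
      ← Finset.sum_mul, ← Finset.mul_sum, (hκ₁ _).sum_eq_one]
    ring
  have hW₁ := isChannel_marginal₁ hW
  have hW₂ := isChannel_marginal₂ hW
  have hzh : ∀ i, (z i).2.1 = outputEntropies W (z i).1 := fun i => (hz i).2.1
  have e₀ : ∑ i, l i • outputEntropies W (z i).1 = e.2.1 := by
    rw [← hze]
    simp [Prod.snd_sum, Prod.fst_sum, hzh]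
  have e₁ : ∑ i, l i • ∑ j, α i j • outputEntropies W (π i j) = e.2.2.1 := by
    rw [← hze]
    simp [Prod.snd_sum, Prod.fst_sum, hπh]
  have e₂ : ∑ i, l i • ∑ j, β i j • outputEntropies W (ρ i j) = e.2.2.2 := by
    rw [← hze]
    simp [Prod.snd_sum, hρh]
  have q₀₁ : condEntropy P B₁ V₀ = e.2.1.1 := by
    rw [(ho₁.comp fun p => p.1.1).condEntropy_mixture hW₁ (fun i => (hz i).1) hl₀, ← e₀]
    simp [Prod.fst_sum, outputEntropies]
  have q₀₂ : condEntropy P B₂ V₀ = e.2.1.2 := by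
    rw [(ho₂.comp fun p => p.1.1).condEntropy_mixture hW₂ (fun i => (hz i).1) hl₀, ← e₀]
    simp [Prod.snd_sum, outputEntropies]
  have q₁₁ : condEntropy P B₁ V₀₁ = e.2.2.1.1 := by
    rw [(ho₁.comp fun p => (p.1.1, p.1.2.1)).condEntropy_mixture hW₁ (l := fun p => l p.1 * α p.1 p.2)
      (d := fun p => π p.1 p.2) (fun p => hπ _ _) fun x p => hl₁ x p.1 p.2, ← e₁]
    simp [Prod.fst_sum, outputEntropies, Fintype.sum_prod_type, Finset.mul_sum,
      mul_assoc]
  have q₁₂ : condEntropy P B₂ V₀₁ = e.2.2.1.2 := by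
    rw [(ho₂.comp fun p => (p.1.1, p.1.2.1)).condEntropy_mixture hW₂ (l := fun p => l p.1 * α p.1 p.2)
      (d := fun p => π p.1 p.2) (fun p => hπ _ _) fun x p => hl₁ x p.1 p.2, ← e₁]
    simp [Prod.snd_sum, outputEntropies, Fintype.sum_prod_type, Finset.mul_sum,
      mul_assoc]
  have q₂₁ : condEntropy P B₁ V₀₂ = e.2.2.2.1 := by
    rw [(ho₁.comp fun p => (p.1.1, p.1.2.2)).condEntropy_mixture hW₁ (l := fun p => l p.1 * β p.1 p.2)
      (d := fun p => ρ p.1 p.2) (fun p => hρ _ _) fun x p => hl₂ x p.1 p.2, ← e₂]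
    simp [Prod.fst_sum, outputEntropies, Fintype.sum_prod_type, Finset.mul_sum,
      mul_assoc]
  have q₂₂ : condEntropy P B₂ V₀₂ = e.2.2.2.2 := by
    rw [(ho₂.comp fun p => (p.1.1, p.1.2.2)).condEntropy_mixture hW₂ (l := fun p => l p.1 * β p.1 p.2)
      (d := fun p => ρ p.1 p.2) (fun p => hρ _ _) fun x p => hl₂ x p.1 p.2, ← e₂]
    simp [Prod.snd_sum, outputEntropies, Fintype.sum_prod_type, Finset.mul_sum,
      mul_assoc]
  have n₁ : condEntropy P B₁ (fun ω => (V₀₂ ω, X' ω)) = noiseEntropy (marginal₁ W) e.1 := by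
    rw [IsOutputGiven.condEntropy_input_eq hW₁ (ho₁.comp fun p => ((p.1.1, p.1.2.2), p.2)), hlX]
    rfl
  have n₂ : condEntropy P B₂ (fun ω => (V₀₁ ω, X' ω)) = noiseEntropy (marginal₂ W) e.1 := by
    rw [IsOutputGiven.condEntropy_input_eq hW₂ (ho₂.comp fun p => ((p.1.1, p.1.2.1), p.2)), hlX]
    rfl
  have b₁ : entropy P B₁ = (outputEntropies W e.1).1 := by
    rw [entropy_eq_hent, ho₁.law_eq, hlX]
    rfl
  have b₂ : entropy P B₂ = (outputEntropies W e.1).2 := by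
    rw [entropy_eq_hent, ho₂.law_eq, hlX]
    rfl
  rw [mutualInfo_eq hP, mutualInfo_eq hP, condMutualInfo_eq hP, condMutualInfo_eq hP,
    condMutualInfo_eq hP, condMutualInfo_eq hP, n₁, n₂, b₁, b₂, q₀₁, q₀₂, q₁₂, q₂₁]
  -- The rewriting leaves the pairs `(V₀, V₁)` and `(V₀, V₂)` written out; they are `V₀₁` and `V₀₂`
  -- by definition.
  change _ ∧ _ ≤ _ + (_ - condEntropy P B₁ V₀₁) ∧ _ ≤ _ + (_ - condEntropy P B₂ V₀₂) ∧
    _ ≤ _ + (_ - condEntropy P B₁ V₀₁) + _ ∧ _ ≤ _ + (_ - condEntropy P B₂ V₀₂) + _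
  rw [q₁₁, q₂₂]
  exact hR

theorem zero_mem_outerRegion {X Y₁ Y₂ : Type*} [Fintype X] [Fintype Y₁]
    [Fintype Y₂] {W : X → Y₁ × Y₂ → ℝ} (hW : IsChannel W) {v : X → ℝ}
    (hv : v ∈ stdSimplex ℝ X) : (0 : ℝ × ℝ × ℝ) ∈ outerRegion v W := by
  refine mem_outerRegion_of_satisfiesOuterBounds hW (mem_layeredHull_self hv) hv le_rfl le_rfl
    le_rfl ?_
  have h1 := noiseEntropy_le (isChannel_marginal₁ hW) hv
  have h2 := noiseEntropy_le (isChannel_marginal₂ hW) hv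
  simpa [SatisfiesOuterBounds, outputEntropies] using ⟨h2, h1⟩

/-! ### Block transmission over a memoryless channel. -/

section Block

variable {Z X Y B C : Type*} [Fintype Z] [Fintype X] [Fintype Y] [Fintype B] [Fintype C] {n : ℕ}

/-- The joint distribution of a message `z` and the output block, when the block `F z` is sent
over the memoryless channel `W`. -/
def blockJoint (μ : Z → ℝ) (W : X → Y → ℝ) (F : Z → Fin n → X) : Z × (Fin n → Y) → ℝ :=
  fun ω => μ ω.1 * ∏ q, W (F ω.1 q) (ω.2 q)

theorem sum_blockJoint_mul (μ : Z → ℝ) {W : X → Y → ℝ} (hW : IsChannel W) (F : Z → Fin n → X)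
    (φ : Z → ℝ) : ∑ ω, blockJoint μ W F ω * φ ω.1 = ∑ z, μ z * φ z := by
  simp only [blockJoint, Fintype.sum_prod_type]
  refine Finset.sum_congr rfl fun z _ => ?_
  rw [← Finset.sum_mul, ← Finset.mul_sum,
    sum_prod_eq_one (fun q => W (F z q)) fun q => hW.sum_eq_one _, mul_one]

theorem blockJoint_mem_stdSimplex {μ : Z → ℝ} (hμ : μ ∈ stdSimplex ℝ Z) {W : X → Y → ℝ}
    (hW : IsChannel W) (F : Z → Fin n → X) :
    blockJoint μ W F ∈ stdSimplex ℝ (Z × (Fin n → Y)) :=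
  ⟨fun ω => mul_nonneg (hμ.1 _) (Finset.prod_nonneg fun q _ => hW.nonneg _ _), by
    simpa [hμ.2] using sum_blockJoint_mul μ hW F fun _ => 1⟩

theorem law_blockJoint (μ : Z → ℝ) {W : X → Y → ℝ} (hW : IsChannel W) (F : Z → Fin n → X)
    (τ : Z → C) : law (blockJoint μ W F) (fun ω => τ ω.1) = law μ τ := by
  classical
  ext t
  rw [law_eq_sum_ite, law_eq_sum_ite, sum_blockJoint_mul μ hW F fun z => if τ z = t then 1 else 0]

theorem prod_update_mul (w : Fin n → Y → ℝ) (y : Fin n → Y) (q : Fin n) (b : Y) :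
    (∏ i, w i (Function.update y q b i)) * w q (y q) = (∏ i, w i (y i)) * w q b := by
  rw [← Finset.mul_prod_erase _ _ (Finset.mem_univ q),
    ← Finset.mul_prod_erase _ (fun i => w i (y i)) (Finset.mem_univ q), Function.update_self]
  have : ∏ i ∈ Finset.univ.erase q, w i (Function.update y q b i) =
      ∏ i ∈ Finset.univ.erase q, w i (y i) :=
    Finset.prod_congr rfl fun i hi => by rw [Function.update_of_ne (Finset.ne_of_mem_erase hi)]
  rw [this]
  ring

/-- Adjoin an independent copy `b` of the letter `y q` and exchange the two: the weight is
invariant, and `Φ` does not notice the exchange. -/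
theorem sum_prod_mul_of_update (w : Fin n → Y → ℝ) (q : Fin n) (hw : ∑ b, w q b = 1)
    (g : Y → ℝ) (Φ : (Fin n → Y) → ℝ) (hΦ : ∀ y b, Φ (Function.update y q b) = Φ y) :
    ∑ y, (∏ i, w i (y i)) * (g (y q) * Φ y) =
      ∑ y, (∏ i, w i (y i)) * ((∑ b, w q b * g b) * Φ y) := by
  have hinv : Function.Involutive
      fun p : (Fin n → Y) × Y => (Function.update p.1 q p.2, p.1 q) := fun p => by simp
  have h := Equiv.sum_comp (hinv.toPerm _)
    fun p : (Fin n → Y) × Y => (∏ i, w i (p.1 i)) * w q p.2 * (g (p.1 q) * Φ p.1)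
  have h1 : ∀ p : (Fin n → Y) × Y, (∏ i, w i (((hinv.toPerm _) p).1 i)) * w q ((hinv.toPerm _) p).2 *
      (g (((hinv.toPerm _) p).1 q) * Φ ((hinv.toPerm _) p).1) =
      (∏ i, w i (p.1 i)) * w q p.2 * (g p.2 * Φ p.1) := fun p => by
    simp only [Function.Involutive.coe_toPerm, Function.update_self, hΦ]
    rw [prod_update_mul]
  simp only [h1, Fintype.sum_prod_type] at h
  refine Eq.trans (Finset.sum_congr rfl fun y _ => ?_)
    (h.symm.trans (Finset.sum_congr rfl fun y _ => ?_))
  · rw [← Finset.sum_mul, ← Finset.mul_sum, hw, mul_one]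
  · rw [Finset.sum_mul, Finset.mul_sum]
    exact Finset.sum_congr rfl fun b _ => by ring

/-- The `q`-th output letter depends on the message and the other outputs only through the `q`-th
input letter. -/
theorem isOutputGiven_blockJoint [DecidableEq B] (μ : Z → ℝ) {W : X → Y → ℝ} (hW : IsChannel W)
    (F : Z → Fin n → X) (q : Fin n) (φ : Y → B) {c : X → B → ℝ}
    (hc : ∀ x b, c x b = ∑ y, W x y * if φ y = b then 1 else 0)
    {T : Z × (Fin n → Y) → C} (hT : ∀ z y b, T (z, Function.update y q b) = T (z, y)) :
    IsOutputGiven (blockJoint μ W F) c (fun ω => F ω.1 q) (fun ω => φ (ω.2 q)) T := by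
  intro b Φ
  simp only [blockJoint, Fintype.sum_prod_type, mul_assoc, ← Finset.mul_sum]
  refine Finset.sum_congr rfl fun z _ => ?_
  congr 1
  have := sum_prod_mul_of_update (fun i => W (F z i)) q (hW.sum_eq_one _)
    (fun y => if φ y = b then 1 else 0) (fun y => Φ (T (z, y))) fun y b' => by rw [hT]
  rw [hc]
  convert this

/-- Given the message, the output letters are independent. -/
theorem condEntropy_blockJoint_eq [DecidableEq B] {μ : Z → ℝ} {W : X → Y → ℝ}
    (F : Z → Fin n → X) (φ : Y → B) {c : X → B → ℝ} (hcc : IsChannel c) (hW : IsChannel W)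
    (hc : ∀ x b, c x b = ∑ y, W x y * if φ y = b then 1 else 0) :
    condEntropy (blockJoint μ W F) (fun ω q => φ (ω.2 q)) (fun ω => ω.1) =
      ∑ q, noiseEntropy c (law μ fun z => F z q) := by
  classical
  have hm : law (blockJoint μ W F) (fun ω => ω.1) = μ := by
    rw [law_blockJoint μ hW F fun z => z]
    ext z
    simp [law, prob]
  rw [condEntropy_eq_sum (c := fun z y => ∏ q, c (F z q) (y q))
    (fun z => prod_mem_stdSimplex fun q => hcc (F z q)) fun b z => ?_]
  · rw [hm]
    simp only [hent_prod _ fun q => hcc.sum_eq_one _, noiseEntropy]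
    simp only [sum_law_mul μ _ fun x => hent (c x), Finset.mul_sum]
    rw [Finset.sum_comm]
  · rw [hm, law_eq_sum_ite, Fintype.sum_prod_type, Finset.sum_eq_single z]
    · have := law_prod (fun q => W (F z q)) (fun _ => φ) b
      simp only [law_eq_sum_ite] at this
      simp only [hc, ← this, blockJoint, mul_assoc, ← Finset.mul_sum, Prod.mk.injEq, and_true]
    · intro z' _ hz
      simp [hz]
    · simp

end Block

/-! ### The Csiszár sum identity. -/

section Mixed

variable {Z Y₁ Y₂ C : Type*} [Fintype Z] [Fintype Y₁] [Fintype Y₂] [Fintype C] {n : ℕ}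

/-- The first outputs at times before `k` and the second outputs from time `l` on. -/
def mixedOutputs (k l : ℕ) (y : Fin n → Y₁ × Y₂) : (Fin n → Option Y₁) × (Fin n → Option Y₂) :=
  (fun i => if i.val < k then some (y i).1 else none,
    fun i => if l ≤ i.val then some (y i).2 else none)

theorem mixedOutputs_eq_iff (k l : ℕ) (y y' : Fin n → Y₁ × Y₂) :
    mixedOutputs k l y = mixedOutputs k l y' ↔
      (∀ i : Fin n, i.val < k → (y i).1 = (y' i).1) ∧
        ∀ i : Fin n, l ≤ i.val → (y i).2 = (y' i).2 := by
  simp only [mixedOutputs, Prod.mk.injEq, funext_iff]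
  refine and_congr (forall_congr' fun i => ?_) (forall_congr' fun i => ?_) <;>
    split_ifs with h <;> simp [h]

/-- With `k = q` and `l = q + 1`, letter `q` is blank in both halves. This is Csiszár's variable
`V_q`, and it is why letter `q` still sees the channel given `V_q`. -/
theorem mixedOutputs_update (q : Fin n) (y : Fin n → Y₁ × Y₂) (b : Y₁ × Y₂) :
    mixedOutputs q (q + 1) (Function.update y q b) = mixedOutputs q (q + 1) y := by
  rw [mixedOutputs_eq_iff]
  constructor <;> intro i hi <;> rw [Function.update_of_ne] <;> rintro rfl <;> omega

variable {P : Z × (Fin n → Y₁ × Y₂) → ℝ} (hP : P ∈ stdSimplex ℝ (Z × (Fin n → Y₁ × Y₂)))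
  (M : Z → C)

include hP

theorem condEntropy_first_mixed (q : Fin n) (l : ℕ) :
    condEntropy P (fun ω => (ω.2 q).1) (fun ω => (M ω.1, mixedOutputs q l ω.2)) =
      entropy P (fun ω => (M ω.1, mixedOutputs (q + 1) l ω.2)) -
        entropy P (fun ω => (M ω.1, mixedOutputs q l ω.2)) := by
  unfold condEntropy
  congr 1
  refine entropy_congr hP fun ω ω' => ?_
  simp only [Prod.mk.injEq, mixedOutputs_eq_iff]
  constructor
  · rintro ⟨h1, h2, h3, h4⟩
    refine ⟨h2, fun i hi => ?_, h4⟩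
    rcases Nat.lt_succ_iff_lt_or_eq.1 hi with h | h
    · exact h3 i h
    · rwa [Fin.ext h]
  · rintro ⟨h2, h3, h4⟩
    exact ⟨h3 q (Nat.lt_succ_self _), h2, fun i hi => h3 i (by omega), h4⟩

theorem condEntropy_second_mixed (q : Fin n) (k : ℕ) :
    condEntropy P (fun ω => (ω.2 q).2) (fun ω => (M ω.1, mixedOutputs k (q + 1) ω.2)) =
      entropy P (fun ω => (M ω.1, mixedOutputs k q ω.2)) -
        entropy P (fun ω => (M ω.1, mixedOutputs k (q + 1) ω.2)) := by
  unfold condEntropy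
  congr 1
  refine entropy_congr hP fun ω ω' => ?_
  simp only [Prod.mk.injEq, mixedOutputs_eq_iff]
  constructor
  · rintro ⟨h1, h2, h3, h4⟩
    refine ⟨h2, h3, fun i hi => ?_⟩
    rcases Nat.lt_or_eq_of_le hi with h | h
    · exact h4 i h
    · rwa [← Fin.ext h]
  · rintro ⟨h2, h3, h4⟩
    exact ⟨h4 q le_rfl, h2, h3, fun i hi => h4 i (by omega)⟩

theorem entropy_mixedOutputs_all :
    entropy P (fun ω => (M ω.1, mixedOutputs n n ω.2)) - entropy P (fun ω => M ω.1) =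
      condEntropy P (fun ω q => (ω.2 q).1) (fun ω => M ω.1) := by
  unfold condEntropy
  congr 1
  refine entropy_congr hP fun ω ω' => ?_
  simp only [Prod.mk.injEq, mixedOutputs_eq_iff, funext_iff]
  constructor
  · rintro ⟨h1, h2, h3⟩
    exact ⟨fun i => h2 i i.2, h1⟩
  · rintro ⟨h1, h2⟩
    exact ⟨h2, fun i _ => h1 i, fun i hi => absurd i.2 (by omega)⟩

theorem entropy_mixedOutputs_zero :
    entropy P (fun ω => (M ω.1, mixedOutputs 0 0 ω.2)) - entropy P (fun ω => M ω.1) =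
      condEntropy P (fun ω q => (ω.2 q).2) (fun ω => M ω.1) := by
  unfold condEntropy
  congr 1
  refine entropy_congr hP fun ω ω' => ?_
  simp only [Prod.mk.injEq, mixedOutputs_eq_iff, funext_iff]
  constructor
  · rintro ⟨h1, h2, h3⟩
    exact ⟨fun i => h3 i (Nat.zero_le _), h1⟩
  · rintro ⟨h1, h2⟩
    exact ⟨h2, fun i hi => absurd hi (by omega), fun i _ => h1 i⟩

/-- The Csiszár sum identity, in telescoped form. -/
theorem sum_condEntropy_mixed_sub :
    ∑ q : Fin n, condEntropy P (fun ω => (ω.2 q).1)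
        (fun ω => (M ω.1, mixedOutputs q (q + 1) ω.2)) -
      ∑ q : Fin n, condEntropy P (fun ω => (ω.2 q).2)
        (fun ω => (M ω.1, mixedOutputs q (q + 1) ω.2)) =
      condEntropy P (fun ω q => (ω.2 q).1) (fun ω => M ω.1) -
        condEntropy P (fun ω q => (ω.2 q).2) (fun ω => M ω.1) := by
  rw [← entropy_mixedOutputs_all hP, ← entropy_mixedOutputs_zero hP, ← Finset.sum_sub_distrib]
  -- Both terms at `q` subtract the entropy with cut `(q, q + 1)`. It drops out, and the entropies
  -- with cuts `(q + 1, q + 1)` and `(q, q)` remain, which telescope.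
  simp only [condEntropy_first_mixed hP, condEntropy_second_mixed hP, sub_sub_sub_cancel_right]
  rw [Fin.sum_univ_eq_sum_range (fun k =>
    entropy P (fun ω => (M ω.1, mixedOutputs (k + 1) (k + 1) ω.2)) -
      entropy P (fun ω => (M ω.1, mixedOutputs k k ω.2))) n,
    Finset.sum_range_sub fun k => entropy P (fun ω => (M ω.1, mixedOutputs k k ω.2))]

/-- Dropping the second outputs from the condition increases each term, and what is left is the
chain rule for the first output block. -/
theorem sum_condEntropy_mixed_le :
    ∑ q : Fin n, condEntropy P (fun ω => (ω.2 q).1)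
        (fun ω => (M ω.1, mixedOutputs q (q + 1) ω.2)) ≤
      condEntropy P (fun ω q => (ω.2 q).1) (fun ω => M ω.1) := by
  have h : ∀ q : Fin n, condEntropy P (fun ω => (ω.2 q).1)
      (fun ω => (M ω.1, mixedOutputs q (q + 1) ω.2)) ≤
      entropy P (fun ω => (M ω.1, mixedOutputs (q + 1) n ω.2)) -
        entropy P (fun ω => (M ω.1, mixedOutputs q n ω.2)) := fun q => by
    rw [← condEntropy_first_mixed hP]
    refine condEntropy_le_of_determines hP _ fun ω ω' => ?_
    simp only [Prod.mk.injEq, mixedOutputs_eq_iff]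
    rintro ⟨h1, h2, h3⟩
    exact ⟨h1, h2, fun i hi => h3 i (by omega)⟩
  refine (Finset.sum_le_sum fun q _ => h q).trans (le_of_eq ?_)
  rw [Fin.sum_univ_eq_sum_range (fun k =>
    entropy P (fun ω => (M ω.1, mixedOutputs (k + 1) n ω.2)) -
      entropy P (fun ω => (M ω.1, mixedOutputs k n ω.2))) n,
    Finset.sum_range_sub fun k => entropy P (fun ω => (M ω.1, mixedOutputs k n ω.2)),
    ← entropy_mixedOutputs_all hP]
  congr 1
  refine entropy_congr hP fun ω ω' => ?_
  simp only [Prod.mk.injEq, mixedOutputs_eq_iff]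
  constructor
  · exact fun h => h.1
  · exact fun h => ⟨h, fun i hi => absurd hi (by omega), fun i hi => absurd i.2 (by omega)⟩

end Mixed

/-! ### Single-letterization. -/

section SingleLetter

variable {Ω X Y₁ Y₂ C C₀ C₁ C₂ : Type*} [Fintype Ω] [Fintype X] [Fintype Y₁] [Fintype Y₂]
  [Fintype C] [Fintype C₀] [Fintype C₁] [Fintype C₂]

theorem law_swap (P : Ω → ℝ) (f : Ω → C) (g : Ω → C₀) (a : C) (b : C₀) :
    law P (fun ω => (f ω, g ω)) (a, b) = law P (fun ω => (g ω, f ω)) (b, a) := by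
  classical
  simp only [law_eq_sum_ite, Prod.mk.injEq, and_comm]

theorem sum_law_last (P : Ω → ℝ) (ξ : Ω → C) (T₀ : Ω → C₀) (T₁ : Ω → C₁) (x : C) (t : C₀) :
    ∑ t₁, law P (fun ω => (ξ ω, (T₀ ω, T₁ ω))) (x, (t, t₁)) =
      law P (fun ω => (ξ ω, T₀ ω)) (x, t) := by
  classical
  simp only [law_eq_sum_ite]
  rw [Finset.sum_comm]
  refine Finset.sum_congr rfl fun ω _ => ?_
  rw [← Finset.mul_sum]
  by_cases h1 : ξ ω = x <;> by_cases h2 : T₀ ω = t <;> simp [h1, h2]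

/-- Conditioning on `T₁` in addition splits each input law `d t` into a mixture. For null `t` the
law `d t` is arbitrary and need not be that mixture, hence the restriction. -/
theorem exists_refinement {P : Ω → ℝ} (hP : P ∈ stdSimplex ℝ Ω) {W : X → Y₁ × Y₂ → ℝ}
    (hW : IsChannel W) {ξ : Ω → X} {f₁ : Ω → Y₁} {f₂ : Ω → Y₂} {T₀ : Ω → C₀} {T₁ : Ω → C₁}
    (h₁ : IsOutputGiven P (marginal₁ W) ξ f₁ fun ω => (T₀ ω, T₁ ω))
    (h₂ : IsOutputGiven P (marginal₂ W) ξ f₂ fun ω => (T₀ ω, T₁ ω)) {d : C₀ → X → ℝ}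
    (hd : ∀ x t, law P (fun ω => (ξ ω, T₀ ω)) (x, t) = law P T₀ t * d t x) :
    ∃ a : C₀ → ℝ × ℝ,
      (∀ t, law P T₀ t ≠ 0 → (d t, a t) ∈ graphHull (outputEntropies W)) ∧
      ∑ t, law P T₀ t • a t =
        (condEntropy P f₁ (fun ω => (T₀ ω, T₁ ω)), condEntropy P f₂ (fun ω => (T₀ ω, T₁ ω))) := by
  obtain ⟨d₁, hd₁, hl₁⟩ := exists_condLaw hP ξ fun ω => (T₀ ω, T₁ ω)
  obtain ⟨e, he, hle⟩ := exists_condLaw hP T₁ T₀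
  have hp : ∀ t t₁, law P (fun ω => (T₀ ω, T₁ ω)) (t, t₁) = law P T₀ t * e t t₁ :=
    fun t t₁ => by rw [law_swap, hle]
  refine ⟨fun t => ∑ t₁, e t t₁ • outputEntropies W (d₁ (t, t₁)), fun t ht => ?_, ?_⟩
  · have hdt : d t = ∑ t₁, e t t₁ • d₁ (t, t₁) := by
      ext x
      refine mul_left_cancel₀ ht ?_
      rw [← hd, ← sum_law_last P ξ T₀ T₁, Finset.sum_apply, Finset.mul_sum]
      refine Finset.sum_congr rfl fun t₁ _ => ?_
      rw [hl₁, hp, Pi.smul_apply, smul_eq_mul, mul_assoc]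
    have := convexCombination_mem_convexHull (he t)
      (z := fun t₁ => (d₁ (t, t₁), outputEntropies W (d₁ (t, t₁))))
      (s := (fun v => (v, outputEntropies W v)) '' stdSimplex ℝ X)
      fun t₁ => ⟨d₁ (t, t₁), hd₁ _, rfl⟩
    have heq : (d t, ∑ t₁, e t t₁ • outputEntropies W (d₁ (t, t₁))) =
        ∑ t₁, e t t₁ • (d₁ (t, t₁), outputEntropies W (d₁ (t, t₁))) := by
      rw [hdt]
      ext1 <;> simp [Prod.fst_sum, Prod.snd_sum]
    rw [graphHull, heq]
    exact this
  · rw [h₁.condEntropy_eq (isChannel_marginal₁ hW) hd₁ hl₁,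
      h₂.condEntropy_eq (isChannel_marginal₂ hW) hd₁ hl₁]
    ext <;> simp [Prod.fst_sum, Prod.snd_sum, Fintype.sum_prod_type, outputEntropies,
      Finset.mul_sum, hp, mul_assoc]

theorem mem_layeredHull_of_isOutputGiven {P : Ω → ℝ} (hP : P ∈ stdSimplex ℝ Ω)
    {W : X → Y₁ × Y₂ → ℝ} (hW : IsChannel W) {ξ : Ω → X} {f₁ : Ω → Y₁} {f₂ : Ω → Y₂}
    {T₀ : Ω → C₀} {T₁ : Ω → C₁} {T₂ : Ω → C₂}
    (h₁ : IsOutputGiven P (marginal₁ W) ξ f₁ fun ω => (T₀ ω, T₁ ω, T₂ ω))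
    (h₂ : IsOutputGiven P (marginal₂ W) ξ f₂ fun ω => (T₀ ω, T₁ ω, T₂ ω)) :
    (law P ξ, (condEntropy P f₁ T₀, condEntropy P f₂ T₀),
      (condEntropy P f₁ (fun ω => (T₀ ω, T₁ ω)), condEntropy P f₂ (fun ω => (T₀ ω, T₁ ω))),
      (condEntropy P f₁ (fun ω => (T₀ ω, T₂ ω)), condEntropy P f₂ (fun ω => (T₀ ω, T₂ ω)))) ∈
      layeredHull (outputEntropies W) := by
  classical
  obtain ⟨d, hd, hdl⟩ := exists_condLaw hP ξ T₀
  obtain ⟨a, ha, has⟩ := exists_refinement hP hW (h₁.comp fun t => (t.1, t.2.1))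
    (h₂.comp fun t => (t.1, t.2.1)) hdl
  obtain ⟨b, hb, hbs⟩ := exists_refinement hP hW (h₁.comp fun t => (t.1, t.2.2))
    (h₂.comp fun t => (t.1, t.2.2)) hdl
  -- At null `t` the trivial refinement of `d t` is used instead; its weight in the mixture is zero.
  have hz : ∀ t, (if law P T₀ t = 0 then (d t, outputEntropies W (d t), outputEntropies W (d t),
      outputEntropies W (d t)) else (d t, outputEntropies W (d t), a t, b t)) ∈
      refinements (outputEntropies W) := fun t => by
    split_ifs with h
    · exact ⟨hd t, rfl, mem_graphHull_self (hd t), mem_graphHull_self (hd t)⟩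
    · exact ⟨hd t, rfl, ha t h, hb t h⟩
  have := convexCombination_mem_convexHull (law_mem_stdSimplex hP T₀) hz
  have heq : ∀ t, law P T₀ t • (if law P T₀ t = 0 then (d t, outputEntropies W (d t),
      outputEntropies W (d t), outputEntropies W (d t)) else
        (d t, outputEntropies W (d t), a t, b t)) =
      law P T₀ t • (d t, outputEntropies W (d t), a t, b t) := fun t => by
    split_ifs with h
    · rw [h, zero_smul, zero_smul]
    · rfl
  simp only [heq] at this
  rw [layeredHull, ← has, ← hbs]
  convert this using 1
  ext1
  · ext x
    simp only [Prod.fst_sum, Prod.smul_fst, Finset.sum_apply, Pi.smul_apply, smul_eq_mul]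
    have h3 : law P ξ x = ∑ t, law P (fun ω => (ξ ω, T₀ ω)) (x, t) := by
      simp only [law_swap P ξ T₀]
      rw [sum_law_fst]
    rw [h3]
    exact Finset.sum_congr rfl fun t _ => hdl x t
  · rw [(h₁.comp fun t => t.1).condEntropy_eq (isChannel_marginal₁ hW) hd hdl,
      (h₂.comp fun t => t.1).condEntropy_eq (isChannel_marginal₂ hW) hd hdl]
    ext <;> simp [Prod.fst_sum, Prod.snd_sum, outputEntropies]

theorem condEntropy_right_comm {P : Ω → ℝ} (hP : P ∈ stdSimplex ℝ Ω) (f : Ω → C) (T₀ : Ω → C₀)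
    (T₁ : Ω → C₁) (T₂ : Ω → C₂) :
    condEntropy P f (fun ω => ((T₀ ω, T₁ ω), T₂ ω)) =
      condEntropy P f (fun ω => ((T₀ ω, T₂ ω), T₁ ω)) :=
  condEntropy_congr hP (fun ω ω' => by simp only [Prod.mk.injEq]; tauto) fun _ _ _ => Iff.rfl

theorem marginal₁_eq (W : X → Y₁ × Y₂ → ℝ) [DecidableEq Y₁] (x : X) (b : Y₁) :
    marginal₁ W x b = ∑ y, W x y * if y.1 = b then 1 else 0 := by
  simp [marginal₁, Fintype.sum_prod_type_right]

theorem marginal₂_eq (W : X → Y₁ × Y₂ → ℝ) [DecidableEq Y₂] (x : X) (b : Y₂) :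
    marginal₂ W x b = ∑ y, W x y * if y.2 = b then 1 else 0 := by
  simp [marginal₂, Fintype.sum_prod_type]

variable {Z : Type*} [Fintype Z] {n : ℕ}

/-- Subadditivity over the letters, then concavity of the entropy at the average input distribution
`v`. -/
theorem entropy_block_le [DecidableEq C] {Y : Type*} [Fintype Y] {μ : Z → ℝ}
    (hμ : μ ∈ stdSimplex ℝ Z)
    {W : X → Y → ℝ} (hW : IsChannel W) (F : Z → Fin n → X) (φ : Y → C) {c : X → C → ℝ}
    (hcc : IsChannel c) (hc : ∀ x b, c x b = ∑ y, W x y * if φ y = b then 1 else 0)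
    {v : X → ℝ} (hv : ∀ x, n * v x = ∑ q, law μ (fun z => F z q) x) :
    entropy (blockJoint μ W F) (fun ω q => φ (ω.2 q)) ≤ n * hent (outLaw c v) := by
  have hP := blockJoint_mem_stdSimplex hμ hW F
  refine (entropy_pi_le hP fun q ω => φ (ω.2 q)).trans ?_
  have hq : ∀ q, entropy (blockJoint μ W F) (fun ω => φ (ω.2 q)) =
      hent (outLaw c (law μ fun z => F z q)) := fun q => by
    rw [entropy_eq_hent, (isOutputGiven_blockJoint μ hW F q φ hc
      (T := fun _ => ()) fun _ _ _ => rfl).law_eq, law_blockJoint μ hW F fun z => F z q]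
  simp only [hq]
  rcases Nat.eq_zero_or_pos n with rfl | hn
  · simp
  have hn' : (0 : ℝ) < n := Nat.cast_pos.2 hn
  have hw : (fun _ : Fin n => (n : ℝ)⁻¹) ∈ stdSimplex ℝ (Fin n) :=
    ⟨fun _ => by positivity, by simp [hn'.ne']⟩
  have := sum_mul_hent_le hw (v := fun q => outLaw c (law μ fun z => F z q)) fun q =>
    (outLaw_mem_stdSimplex hcc (law_mem_stdSimplex hμ _)).1
  rw [← Finset.mul_sum, inv_mul_le_iff₀ hn'] at this
  refine this.trans (le_of_eq ?_)
  congr 2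
  ext b
  simp only [outLaw, ← Finset.mul_sum]
  rw [Finset.sum_comm]
  simp only [← Finset.sum_mul, ← hv, Finset.mul_sum]
  refine Finset.sum_congr rfl fun x _ => ?_
  field_simp

/-- Given the full message the letters are independent, and `noiseEntropy` is linear in the input
law, so averaging loses nothing. Any `M` is a function of the message and leaves at least this
entropy. -/
theorem noiseEntropy_block_le [DecidableEq C] {Y : Type*} [Fintype Y] {μ : Z → ℝ}
    (hμ : μ ∈ stdSimplex ℝ Z)
    {W : X → Y → ℝ} (hW : IsChannel W) (F : Z → Fin n → X) (φ : Y → C) {c : X → C → ℝ}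
    (hcc : IsChannel c) (hc : ∀ x b, c x b = ∑ y, W x y * if φ y = b then 1 else 0)
    {v : X → ℝ} (hv : ∀ x, n * v x = ∑ q, law μ (fun z => F z q) x) (M : Z → C₀) :
    n * noiseEntropy c v ≤
      condEntropy (blockJoint μ W F) (fun ω q => φ (ω.2 q)) (fun ω => M ω.1) := by
  have hP := blockJoint_mem_stdSimplex hμ hW F
  have h1 : n * noiseEntropy c v = condEntropy (blockJoint μ W F) (fun ω q => φ (ω.2 q))
      (fun ω => ω.1) := by
    rw [condEntropy_blockJoint_eq F φ hcc hW hc]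
    simp only [noiseEntropy]
    rw [Finset.sum_comm]
    simp only [← Finset.sum_mul, ← hv, Finset.mul_sum, mul_assoc]
  rw [h1]
  exact condEntropy_le_of_determines hP _ fun ω ω' h => by rw [h]

/-- Single-letterization of the block entropies: up to a correction that is the same for both
receivers, the conditional block entropies are `n` times the coordinates of a point of the
layered hull over the average input distribution. -/
theorem exists_layeredHull_of_block {μ : Z → ℝ} (hμ : μ ∈ stdSimplex ℝ Z)
    {W : X → Y₁ × Y₂ → ℝ} (hW : IsChannel W) (F : Z → Fin n → X) {v : X → ℝ}
    (hvs : v ∈ stdSimplex ℝ X) (hv : ∀ x, n * v x = ∑ q, law μ (fun z => F z q) x)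
    (M₀ : Z → C₀) (M₁ : Z → C₁) (M₂ : Z → C₂) :
    ∃ e ∈ layeredHull (outputEntropies W), e.1 = v ∧
      ∃ δ₀ δ₁ δ₂ : ℝ, 0 ≤ δ₀ ∧ 0 ≤ δ₁ ∧ 0 ≤ δ₂ ∧
        let P := blockJoint μ W F
        let B₁ : Z × (Fin n → Y₁ × Y₂) → Fin n → Y₁ := fun ω q => (ω.2 q).1
        let B₂ : Z × (Fin n → Y₁ × Y₂) → Fin n → Y₂ := fun ω q => (ω.2 q).2
        condEntropy P B₁ (fun ω => M₀ ω.1) = n * e.2.1.1 + δ₀ ∧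
        condEntropy P B₂ (fun ω => M₀ ω.1) = n * e.2.1.2 + δ₀ ∧
        condEntropy P B₁ (fun ω => (M₀ ω.1, M₁ ω.1)) = n * e.2.2.1.1 + δ₁ ∧
        condEntropy P B₂ (fun ω => (M₀ ω.1, M₁ ω.1)) = n * e.2.2.1.2 + δ₁ ∧
        condEntropy P B₁ (fun ω => (M₀ ω.1, M₂ ω.1)) = n * e.2.2.2.1 + δ₂ ∧
        condEntropy P B₂ (fun ω => (M₀ ω.1, M₂ ω.1)) = n * e.2.2.2.2 + δ₂ := by
  classical
  have hP := blockJoint_mem_stdSimplex hμ hW F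
  set P := blockJoint μ W F with hPdef
  let V : Fin n → Z × (Fin n → Y₁ × Y₂) → (Fin n → Option Y₁) × (Fin n → Option Y₂) :=
    fun q ω => mixedOutputs q (q + 1) ω.2
  let pt : Fin n → (X → ℝ) × (ℝ × ℝ) × (ℝ × ℝ) × (ℝ × ℝ) := fun q =>
    (law μ (fun z => F z q),
      (condEntropy P (fun ω => (ω.2 q).1) (fun ω => (M₀ ω.1, V q ω)),
        condEntropy P (fun ω => (ω.2 q).2) (fun ω => (M₀ ω.1, V q ω))),
      (condEntropy P (fun ω => (ω.2 q).1) (fun ω => ((M₀ ω.1, M₁ ω.1), V q ω)),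
        condEntropy P (fun ω => (ω.2 q).2) (fun ω => ((M₀ ω.1, M₁ ω.1), V q ω))),
      (condEntropy P (fun ω => (ω.2 q).1) (fun ω => ((M₀ ω.1, M₂ ω.1), V q ω)),
        condEntropy P (fun ω => (ω.2 q).2) (fun ω => ((M₀ ω.1, M₂ ω.1), V q ω))))
  have hpt : ∀ q, pt q ∈ layeredHull (outputEntropies W) := fun q => by
    have hT : ∀ z y b, ((fun ω : Z × (Fin n → Y₁ × Y₂) => ((M₀ ω.1, V q ω), M₁ ω.1, M₂ ω.1))
        (z, Function.update y q b)) =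
        (fun ω : Z × (Fin n → Y₁ × Y₂) => ((M₀ ω.1, V q ω), M₁ ω.1, M₂ ω.1)) (z, y) :=
      fun z y b => by simp only [V, mixedOutputs_update]
    -- The variable `V q` joins `M₀` in the base layer; `M₁` and `M₂` are the refinements.
    have := mem_layeredHull_of_isOutputGiven hP hW (T₀ := fun ω => (M₀ ω.1, V q ω))
      (T₁ := fun ω => M₁ ω.1) (T₂ := fun ω => M₂ ω.1)
      (isOutputGiven_blockJoint μ hW F q Prod.fst (marginal₁_eq W) hT)
      (isOutputGiven_blockJoint μ hW F q Prod.snd (marginal₂_eq W) hT)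
    rw [show law P (fun ω => F ω.1 q) = law μ fun z => F z q from
      law_blockJoint μ hW F fun z => F z q] at this
    simpa only [pt, condEntropy_right_comm hP _ (fun ω => M₀ ω.1) (V q)] using this
  obtain ⟨e, he, hev, hen⟩ : ∃ e ∈ layeredHull (outputEntropies W), e.1 = v ∧
      (n : ℝ) • e = ∑ q, pt q := by
    rcases Nat.eq_zero_or_pos n with rfl | hn
    -- For `n = 0` any point over `v` will do.
    · exact ⟨_, mem_layeredHull_self hvs, rfl, by simp⟩
    have hn' : (0 : ℝ) < n := Nat.cast_pos.2 hn
    refine ⟨∑ q, (n : ℝ)⁻¹ • pt q, (convex_convexHull ℝ _).sum_mem (fun _ _ => by positivity)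
      (by simp [hn'.ne']) fun q _ => hpt q, ?_, ?_⟩
    · ext x
      rw [← Finset.smul_sum]
      simp only [Prod.smul_fst, Prod.fst_sum, Pi.smul_apply, Finset.sum_apply, pt, smul_eq_mul,
        ← hv]
      field_simp
    · rw [← Finset.smul_sum, smul_smul, mul_inv_cancel₀ hn'.ne', one_smul]
  have s₀ := sum_condEntropy_mixed_sub hP M₀
  have s₁ := sum_condEntropy_mixed_sub hP fun z => (M₀ z, M₁ z)
  have s₂ := sum_condEntropy_mixed_sub hP fun z => (M₀ z, M₂ z)
  have t₀ := sum_condEntropy_mixed_le hP M₀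
  have t₁ := sum_condEntropy_mixed_le hP fun z => (M₀ z, M₁ z)
  have t₂ := sum_condEntropy_mixed_le hP fun z => (M₀ z, M₂ z)
  have c₀₁ := congrArg (fun p => p.2.1.1) hen
  have c₀₂ := congrArg (fun p => p.2.1.2) hen
  have c₁₁ := congrArg (fun p => p.2.2.1.1) hen
  have c₁₂ := congrArg (fun p => p.2.2.1.2) hen
  have c₂₁ := congrArg (fun p => p.2.2.2.1) hen
  have c₂₂ := congrArg (fun p => p.2.2.2.2) hen
  simp only [Prod.smul_fst, Prod.smul_snd, Prod.fst_sum, Prod.snd_sum, smul_eq_mul, pt, V]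
    at c₀₁ c₀₂ c₁₁ c₁₂ c₂₁ c₂₂
  -- Each `δ` is the gap for the first receiver; the sum identity makes it the gap for the second as
  -- well.
  refine ⟨e, he, hev, _, _, _, sub_nonneg.2 t₀, sub_nonneg.2 t₁, sub_nonneg.2 t₂, ?_⟩
  dsimp only
  refine ⟨?_, ?_, ?_, ?_, ?_, ?_⟩ <;> linarith

end SingleLetter

/-! ### Fano's inequality and equivocation bounds. -/

section Fano

variable {Ω A B C : Type*} [Fintype Ω] [Fintype A] [Fintype B] [Fintype C]

/-- Fano's bound on the conditional entropy of a letter of an alphabet of size `N` that is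
guessed with error probability `t`. -/
def fanoBound (N : ℕ) (t : ℝ) : ℝ := (Real.binEntropy t + t * Real.log N) / Real.log 2

theorem continuous_fanoBound (N : ℕ) : Continuous (fanoBound N) := by
  unfold fanoBound
  fun_prop

theorem fanoBound_zero (N : ℕ) : fanoBound N 0 = 0 := by simp [fanoBound]

theorem fanoBound_nonneg (N : ℕ) {t : ℝ} (h0 : 0 ≤ t) (h1 : t ≤ 1) : 0 ≤ fanoBound N t :=
  div_nonneg (add_nonneg (Real.binEntropy_nonneg h0 h1)
    (mul_nonneg h0 (Real.log_natCast_nonneg N))) log_two_pos.le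

theorem prob_eq_sum_ite (P : Ω → ℝ) (e : Ω → Prop) [DecidablePred e] :
    prob P e = ∑ ω, P ω * if e ω then 1 else 0 := by
  unfold prob
  refine Finset.sum_congr rfl fun ω _ => ?_
  split_ifs <;> simp

theorem prob_comp (P : Ω → ℝ) (f : Ω → A) (e : A → Prop) :
    prob P (fun ω => e (f ω)) = prob (law P f) e := by
  classical
  rw [prob_eq_sum_ite, prob_eq_sum_ite, sum_law_mul P f fun a => if e a then 1 else 0]

theorem prob_le_one {P : Ω → ℝ} (hP : P ∈ stdSimplex ℝ Ω) (e : Ω → Prop) : prob P e ≤ 1 := by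
  classical
  rw [← hP.2, prob_eq_sum_ite]
  refine Finset.sum_le_sum fun ω _ => ?_
  have := hP.1 ω
  split_ifs <;> simp [this]

theorem sum_negMulLog_le (x : A → ℝ) (hx : ∀ a, 0 ≤ x a) :
    ∑ a, Real.negMulLog (x a) ≤
      Real.negMulLog (∑ a, x a) + (∑ a, x a) * Real.log (Fintype.card A) := by
  rcases isEmpty_or_nonempty A with h | h
  · simp
  have hN : (0 : ℝ) < Fintype.card A := Nat.cast_pos.2 Fintype.card_pos
  have := Real.concaveOn_negMulLog.le_map_sum (t := Finset.univ)
    (w := fun _ : A => (Fintype.card A : ℝ)⁻¹) (p := x) (fun _ _ => by positivity)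
    (by simp [hN.ne']) fun a _ => hx a
  simp only [smul_eq_mul, ← Finset.mul_sum] at this
  rw [Real.negMulLog_mul, inv_mul_le_iff₀ hN] at this
  refine this.trans (le_of_eq ?_)
  rw [Real.negMulLog, Real.log_inv]
  field_simp
  ring

theorem fano_inequality {P : Ω → ℝ} (hP : P ∈ stdSimplex ℝ Ω) (s s' : Ω → A) :
    condEntropy P s s' ≤ fanoBound (Fintype.card A) (prob P fun ω => s ω ≠ s' ω) := by
  classical
  -- Given `s'`, the variables `s` and `r` determine each other, while `r` differs from `none` only
  -- on the error event.
  let r : Ω → Option A := fun ω => if s ω = s' ω then none else some (s ω)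
  have h1 : condEntropy P s s' = condEntropy P r s' :=
    condEntropy_congr hP (fun _ _ => Iff.rfl) fun ω ω' h => by
      simp only [r, h]
      split_ifs with h1 h2 h2 <;> simp_all [eq_comm]
  rw [h1]
  refine (condEntropy_le_entropy hP r s').trans ?_
  have hsome : ∑ a, law P r (some a) = prob P fun ω => s ω ≠ s' ω := by
    simp only [law_eq_sum_ite, prob_eq_sum_ite]
    rw [Finset.sum_comm]
    refine Finset.sum_congr rfl fun ω _ => ?_
    rw [← Finset.mul_sum]
    by_cases h : s ω = s' ω <;> simp [r, h]
  have hnone : law P r none = 1 - prob P fun ω => s ω ≠ s' ω := by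
    have := (law_mem_stdSimplex hP r).2
    rw [Fintype.sum_option, hsome] at this
    linarith
  unfold entropy fanoBound
  refine div_le_div_of_nonneg_right ?_ log_two_pos.le
  rw [Fintype.sum_option, hnone, Real.binEntropy_eq_negMulLog_add_negMulLog_one_sub, ← hsome]
  have := sum_negMulLog_le (fun a => law P r (some a)) fun a => law_nonneg hP.1 _ _
  linarith

/-- Fano's inequality letter by letter; concavity of the binary entropy then passes to the average
error probability. -/
theorem fano_inequality_block {P : Ω → ℝ} (hP : P ∈ stdSimplex ℝ Ω) {m : ℕ} (hm : 0 < m)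
    (s : Ω → Fin m → A) (b : Ω → B) (g : B → Fin m → A) :
    condEntropy P s b ≤ m * fanoBound (Fintype.card A)
      (1 / (m : ℝ) * ∑ t, prob P fun ω => s ω t ≠ g (b ω) t) := by
  have hm' : (0 : ℝ) < m := Nat.cast_pos.2 hm
  have h1 : condEntropy P s b ≤
      ∑ t, fanoBound (Fintype.card A) (prob P fun ω => s ω t ≠ g (b ω) t) := by
    refine (condEntropy_pi_le hP b fun t ω => s ω t).trans (Finset.sum_le_sum fun t _ => ?_)
    refine (condEntropy_le_of_determines hP _ fun ω ω' h => ?_).trans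
      (fano_inequality hP (fun ω => s ω t) fun ω => g (b ω) t)
    rw [h]
  have h2 := Real.strictConcave_binEntropy.concaveOn.le_map_sum (t := Finset.univ)
    (w := fun _ : Fin m => (m : ℝ)⁻¹) (p := fun t => prob P fun ω => s ω t ≠ g (b ω) t)
    (fun _ _ => by positivity) (by simp [hm'.ne']) fun t _ =>
      ⟨prob_nonneg hP.1 _, prob_le_one hP _⟩
  simp only [smul_eq_mul, ← Finset.mul_sum] at h2
  rw [inv_mul_le_iff₀ hm'] at h2
  refine h1.trans ?_
  unfold fanoBound
  rw [← Finset.sum_div, mul_div_assoc']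
  refine div_le_div_of_nonneg_right ?_ log_two_pos.le
  rw [Finset.sum_add_distrib, ← Finset.sum_mul, mul_add, one_div]
  refine add_le_add h2 (le_of_eq ?_)
  field_simp

/-- Information about `g` passes through `b` up to the equivocation of `g` given `b`. -/
theorem mutualInfo_le_of_equivocation {P : Ω → ℝ} (hP : P ∈ stdSimplex ℝ Ω) (f : Ω → A)
    (g : Ω → B) (b : Ω → C) :
    mutualInfo P f g ≤ entropy P b - condEntropy P b f + condEntropy P g b := by
  have h1 := condEntropy_nonneg hP g fun ω => (f ω, b ω)
  have h2 := condEntropy_pair_le hP f b g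
  have e1 : entropy P (fun ω => (f ω, (b ω, g ω))) = entropy P (fun ω => (g ω, (f ω, b ω))) :=
    entropy_congr hP fun ω ω' => by simp only [Prod.mk.injEq]; tauto
  have e2 : entropy P (fun ω => (b ω, g ω)) = entropy P (fun ω => (g ω, b ω)) :=
    entropy_congr hP fun ω ω' => by simp only [Prod.mk.injEq]; tauto
  have e3 : entropy P (fun ω => (f ω, b ω)) = entropy P (fun ω => (b ω, f ω)) :=
    entropy_congr hP fun ω ω' => by simp only [Prod.mk.injEq]; tauto
  unfold mutualInfo condEntropy at *
  linarith

/-- `H(g | f) = I(g; b | f) + H(g | f, b)`, and the last term is at most `H(g | b)`. -/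
theorem condEntropy_le_of_equivocation {P : Ω → ℝ} (hP : P ∈ stdSimplex ℝ Ω) (f : Ω → A)
    (g : Ω → B) (b : Ω → C) :
    condEntropy P g f ≤
      condEntropy P b f - condEntropy P b (fun ω => (f ω, g ω)) + condEntropy P g b := by
  have h1 := condEntropy_pair_le hP g f b
  have e1 : entropy P (fun ω => (g ω, (f ω, b ω))) = entropy P (fun ω => (b ω, (f ω, g ω))) :=
    entropy_congr hP fun ω ω' => by simp only [Prod.mk.injEq]; tauto
  have e2 : entropy P (fun ω => (f ω, g ω)) = entropy P (fun ω => (g ω, f ω)) :=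
    entropy_congr hP fun ω ω' => by simp only [Prod.mk.injEq]; tauto
  have e3 : entropy P (fun ω => (f ω, b ω)) = entropy P (fun ω => (b ω, f ω)) :=
    entropy_congr hP fun ω ω' => by simp only [Prod.mk.injEq]; tauto
  unfold condEntropy at *
  linarith

theorem condEntropy_chain {P : Ω → ℝ} (hP : P ∈ stdSimplex ℝ Ω) (f : Ω → A)
    (g : Ω → B) (h : Ω → C) :
    condEntropy P (fun ω => (f ω, g ω)) h =
      condEntropy P f h + condEntropy P g (fun ω => (h ω, f ω)) := by
  have e1 : entropy P (fun ω => ((f ω, g ω), h ω)) = entropy P (fun ω => (g ω, (h ω, f ω))) :=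
    entropy_congr hP fun ω ω' => by simp only [Prod.mk.injEq]; tauto
  have e2 : entropy P (fun ω => (f ω, h ω)) = entropy P (fun ω => (h ω, f ω)) :=
    entropy_congr hP fun ω ω' => by simp only [Prod.mk.injEq]; tauto
  unfold condEntropy
  linarith

end Fano

/-! ### Information quantities of i.i.d. blocks. -/

section IID

variable {A B C X Y : Type*} [Fintype A] [Fintype B] [Fintype C] [Fintype X] [Fintype Y]
  {m n : ℕ}

/-- The i.i.d. block distribution. -/
def iid (m : ℕ) (v : A → ℝ) : (Fin m → A) → ℝ := fun z => ∏ t, v (z t)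

theorem iid_mem_stdSimplex {v : A → ℝ} (hv : v ∈ stdSimplex ℝ A) :
    iid m v ∈ stdSimplex ℝ (Fin m → A) :=
  prod_mem_stdSimplex fun _ => hv

variable {v : A → ℝ} (hv : v ∈ stdSimplex ℝ A) {W : X → Y → ℝ} (hW : IsChannel W)
  (F : (Fin m → A) → Fin n → X)

include hv hW

theorem entropy_iid (φ : A → B) :
    entropy (blockJoint (iid m v) W F) (fun ω t => φ (ω.1 t)) = m * entropy v φ := by
  rw [entropy_eq_hent, law_blockJoint (iid m v) hW F fun z t => φ (z t)]
  exact entropy_prod hv φ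

theorem condEntropy_iid (φ : A → B) (ψ : A → C) :
    condEntropy (blockJoint (iid m v) W F) (fun ω t => φ (ω.1 t)) (fun ω t => ψ (ω.1 t)) =
      m * condEntropy v φ ψ := by
  unfold condEntropy
  rw [mul_sub, ← entropy_iid hv hW F, ← entropy_iid hv hW F]
  congr 1
  refine entropy_congr (blockJoint_mem_stdSimplex (iid_mem_stdSimplex hv) hW F) fun ω ω' => ?_
  simp only [Prod.mk.injEq, funext_iff, forall_and]

theorem mutualInfo_iid (φ : A → B) (ψ : A → C) :
    mutualInfo (blockJoint (iid m v) W F) (fun ω t => φ (ω.1 t)) (fun ω t => ψ (ω.1 t)) =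
      m * mutualInfo v φ ψ := by
  unfold mutualInfo
  rw [entropy_iid hv hW, condEntropy_iid hv hW, mul_sub]

end IID

/-! ### Attaching the auxiliary variable to the source. -/

section Source

variable {S₁ S₂ X Y₁ Y₂ U : Type*} [Fintype S₁] [Fintype S₂] [Fintype X]
  [Fintype Y₁] [Fintype Y₂] [Fintype U] {m n : ℕ}

theorem sourceJoint_mem_stdSimplex {p : S₁ × S₂ → ℝ} (hp : p ∈ stdSimplex ℝ (S₁ × S₂))
    {K : S₁ × S₂ → U → ℝ} (hK : IsChannel K) :
    sourceJoint p K ∈ stdSimplex ℝ (U × S₁ × S₂) := by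
  refine ⟨fun ω => mul_nonneg (hK.nonneg _ _) (hp.1 _), ?_⟩
  rw [← hp.2, Fintype.sum_prod_type, Finset.sum_comm]
  simp only [sourceJoint, ← Finset.sum_mul, hK.sum_eq_one, one_mul]

theorem law_sourceJoint_snd (p : S₁ × S₂ → ℝ) {K : S₁ × S₂ → U → ℝ} (hK : IsChannel K) :
    law (sourceJoint p K) (fun ω => ω.2) = p := by
  classical
  ext s
  rw [law_eq_sum_ite, Fintype.sum_prod_type, Finset.sum_comm]
  simp [sourceJoint, ← Finset.sum_mul, hK.sum_eq_one]

theorem law_iid_sourceJoint (p : S₁ × S₂ → ℝ) {K : S₁ × S₂ → U → ℝ} (hK : IsChannel K) :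
    law (iid m (sourceJoint p K)) (fun z t => (z t).2) = iid m p := by
  ext s
  refine (law_prod (fun _ => sourceJoint p K) (fun _ a => a.2) s).trans ?_
  simp only [law_sourceJoint_snd p hK, iid]

/-- The encoder ignores `U^m`, so summing it out restores the original code. The error probabilities
thus do not depend on `K`. -/
theorem codeJoint_eq_law (p : S₁ × S₂ → ℝ) {K : S₁ × S₂ → U → ℝ} (hK : IsChannel K)
    (W : X → Y₁ × Y₂ → ℝ) (f : (Fin m → S₁) → (Fin m → S₂) → (Fin n → X)) :
    codeJoint p W f = law (blockJoint (iid m (sourceJoint p K)) W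
      fun z => f (fun t => (z t).2.1) (fun t => (z t).2.2))
      (fun ω => ((fun t => (ω.1 t).2.1), (fun t => (ω.1 t).2.2), (fun q => (ω.2 q).1),
        fun q => (ω.2 q).2)) := by
  classical
  ext ⟨s₁, s₂, y₁, y₂⟩
  have h1 := congrFun (law_iid_sourceJoint (m := m) p hK) fun t => (s₁ t, s₂ t)
  rw [law_eq_sum_ite] at h1 ⊢
  rw [Fintype.sum_prod_type]
  simp only [codeJoint]
  change iid m p (fun t => (s₁ t, s₂ t)) * _ = _
  rw [← h1, Finset.sum_mul]
  refine Finset.sum_congr rfl fun z _ => ?_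
  rw [Finset.sum_eq_single fun q => (y₁ q, y₂ q)]
  · by_cases hz : (fun t => (z t).2) = fun t => (s₁ t, s₂ t)
    · have hz1 : (fun t => (z t).2.1) = s₁ := funext fun t => by rw [congrFun hz t]
      have hz2 : (fun t => (z t).2.2) = s₂ := funext fun t => by rw [congrFun hz t]
      simp [blockJoint, hz, hz1, hz2]
    · have hz' : ¬((fun t => (z t).2.1) = s₁ ∧ (fun t => (z t).2.2) = s₂) := by
        rintro ⟨rfl, rfl⟩
        exact hz rfl
      rw [if_neg hz, if_neg]
      · simp
      · simp only [Prod.mk.injEq]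
        tauto
  · intro y _ hy
    rw [if_neg, mul_zero]
    simp only [Prod.mk.injEq]
    rintro ⟨-, -, rfl, rfl⟩
    exact hy rfl
  · simp

end Source

/-! ### The converse for a single code and its limit. -/

section Converse

variable {S₁ S₂ X Y₁ Y₂ : Type*} [Fintype S₁] [Fintype S₂] [Fintype X]
  [Fintype Y₁] [Fintype Y₂]

/-- The bounds of the outer region at a point of the layered hull, scaled by `r` and relaxed
by `s`. -/
def SatisfiesScaledBounds (W : X → Y₁ × Y₂ → ℝ) (e : (X → ℝ) × (ℝ × ℝ) × (ℝ × ℝ) × (ℝ × ℝ))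
    (r s : ℝ) (R : ℝ × ℝ × ℝ) : Prop :=
  let h := outputEntropies W e.1
  let I := min (h.1 - e.2.1.1) (h.2 - e.2.1.2)
  R.1 - s ≤ r * I ∧
  R.1 + R.2.1 - s ≤ r * (I + (e.2.1.1 - e.2.2.1.1)) ∧
  R.1 + R.2.2 - s ≤ r * (I + (e.2.1.2 - e.2.2.2.2)) ∧
  R.1 + R.2.1 + R.2.2 - s ≤
    r * (I + (e.2.1.1 - e.2.2.1.1) + (e.2.2.1.2 - noiseEntropy (marginal₂ W) e.1)) ∧
  R.1 + R.2.1 + R.2.2 - s ≤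
    r * (I + (e.2.1.2 - e.2.2.2.2) + (e.2.2.2.1 - noiseEntropy (marginal₁ W) e.1))

theorem continuous_noiseEntropy {B : Type*} [Fintype B] (c : X → B → ℝ) :
    Continuous (noiseEntropy c) := by
  unfold noiseEntropy
  fun_prop

theorem isClosed_satisfiesScaledBounds (W : X → Y₁ × Y₂ → ℝ) (R : ℝ × ℝ × ℝ) :
    IsClosed {x : ((X → ℝ) × (ℝ × ℝ) × (ℝ × ℝ) × (ℝ × ℝ)) × ℝ × ℝ |
      SatisfiesScaledBounds W x.1 x.2.1 x.2.2 R} := by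
  have h := continuous_outputEntropies W
  have h1 := continuous_noiseEntropy (marginal₁ W)
  have h2 := continuous_noiseEntropy (marginal₂ W)
  unfold SatisfiesScaledBounds
  generalize outputEntropies W = g at h ⊢
  generalize noiseEntropy (marginal₁ W) = g₁ at h1 ⊢
  generalize noiseEntropy (marginal₂ W) = g₂ at h2 ⊢
  simp only [Set.ofPred_and]
  refine (isClosed_le ?_ ?_).inter ((isClosed_le ?_ ?_).inter ((isClosed_le ?_ ?_).inter
    ((isClosed_le ?_ ?_).inter (isClosed_le ?_ ?_)))) <;> fun_prop

/-- Every code turns the source region into scaled and relaxed outer bounds. -/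
theorem exists_satisfiesScaledBounds [Nonempty X] {p : S₁ × S₂ → ℝ}
    (hp : p ∈ stdSimplex ℝ (S₁ × S₂)) {W : X → Y₁ × Y₂ → ℝ} (hW : IsChannel W) {m n : ℕ}
    (hm : 0 < m) (f : (Fin m → S₁) → (Fin m → S₂) → (Fin n → X))
    (g₁ : (Fin n → Y₁) → (Fin m → S₁)) (g₂ : (Fin n → Y₂) → (Fin m → S₂)) :
    ∃ v ∈ stdSimplex ℝ X, ∀ R ∈ sourceRegion p, ∃ e ∈ layeredHull (outputEntropies W),
      e.1 = v ∧ SatisfiesScaledBounds W e ((n : ℝ) / m)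
        (2 * (fanoBound (Fintype.card S₁) (1 / (m : ℝ) *
            ∑ t, prob (codeJoint p W f) (fun ω => ω.1 t ≠ g₁ ω.2.2.1 t)) +
          fanoBound (Fintype.card S₂) (1 / (m : ℝ) *
            ∑ t, prob (codeJoint p W f) (fun ω => ω.2.1 t ≠ g₂ ω.2.2.2 t)))) R := by
  classical
  obtain ⟨x₀⟩ := ‹Nonempty X›
  have hm' : (0 : ℝ) < m := Nat.cast_pos.2 hm
  -- The average input distribution is fixed before the triple `R`. For `n = 0` nothing is averaged
  -- and a point mass serves.
  obtain ⟨v, hvs, hv⟩ : ∃ v ∈ stdSimplex ℝ X, ∀ x, n * v x =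
      ∑ q, law (iid m p) (fun s => f (fun t => (s t).1) (fun t => (s t).2) q) x := by
    rcases Nat.eq_zero_or_pos n with rfl | hn
    · exact ⟨Pi.single x₀ 1, single_mem_stdSimplex ℝ x₀, by simp⟩
    have hn' : (0 : ℝ) < n := Nat.cast_pos.2 hn
    refine ⟨∑ q, (n : ℝ)⁻¹ • law (iid m p) fun s => f (fun t => (s t).1) (fun t => (s t).2) q,
      (convex_stdSimplex ℝ X).sum_mem (fun _ _ => by positivity) (by simp [hn'.ne'])
        fun q _ => law_mem_stdSimplex (iid_mem_stdSimplex hp) _, fun x => ?_⟩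
    rw [← Finset.smul_sum]
    simp only [Pi.smul_apply, Finset.sum_apply, smul_eq_mul]
    field_simp
  refine ⟨v, hvs, ?_⟩
  rintro R ⟨-, -, -, k, -, K, hK, hR⟩
  dsimp only at hR
  obtain ⟨r0, r1, r2, r3⟩ := hR
  set Q := sourceJoint p K
  have hQ : Q ∈ stdSimplex ℝ (Fin k × S₁ × S₂) := sourceJoint_mem_stdSimplex hp hK
  let F : (Fin m → Fin k × S₁ × S₂) → Fin n → X :=
    fun z => f (fun t => (z t).2.1) (fun t => (z t).2.2)
  have hvF : ∀ x, n * v x = ∑ q, law (iid m Q) (fun z => F z q) x := fun x => by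
    rw [hv]
    refine Finset.sum_congr rfl fun q _ => ?_
    rw [← law_iid_sourceJoint p hK, ← law_comp]
  have hμ : iid m Q ∈ stdSimplex ℝ (Fin m → Fin k × S₁ × S₂) := iid_mem_stdSimplex hQ
  obtain ⟨e, he, hev, δ₀, δ₁, δ₂, hδ₀, hδ₁, hδ₂, a₀₁, a₀₂, a₁₁, a₁₂, a₂₁, a₂₂⟩ :=
    exists_layeredHull_of_block hμ hW F hvs hvF (fun z t => (z t).1) (fun z t => (z t).2.1)
      fun z t => (z t).2.2
  refine ⟨e, he, hev, ?_⟩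
  have hP := blockJoint_mem_stdSimplex hμ hW F
  have u₁ := entropy_block_le hμ hW F Prod.fst (isChannel_marginal₁ hW) (marginal₁_eq W) hvF
  have u₂ := entropy_block_le hμ hW F Prod.snd (isChannel_marginal₂ hW) (marginal₂_eq W) hvF
  have w₁ := noiseEntropy_block_le hμ hW F Prod.fst (isChannel_marginal₁ hW) (marginal₁_eq W) hvF
    fun z => (((fun t => (z t).1), (fun t => (z t).2.2)), (fun t => (z t).2.1))
  have w₂ := noiseEntropy_block_le hμ hW F Prod.snd (isChannel_marginal₂ hW) (marginal₂_eq W) hvF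
    fun z => (((fun t => (z t).1), (fun t => (z t).2.1)), (fun t => (z t).2.2))
  have f₁ := fano_inequality_block hP hm (fun ω t => (ω.1 t).2.1) (fun ω q => (ω.2 q).1) g₁
  have f₂ := fano_inequality_block hP hm (fun ω t => (ω.1 t).2.2) (fun ω q => (ω.2 q).2) g₂
  have p₁ : ∀ t, prob (codeJoint p W f) (fun ω => ω.1 t ≠ g₁ ω.2.2.1 t) =
      prob (blockJoint (iid m Q) W F) (fun ω => (ω.1 t).2.1 ≠ g₁ (fun q => (ω.2 q).1) t) :=
    fun t => by
      rw [codeJoint_eq_law p hK W f, ← prob_comp]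
  have p₂ : ∀ t, prob (codeJoint p W f) (fun ω => ω.2.1 t ≠ g₂ ω.2.2.2 t) =
      prob (blockJoint (iid m Q) W F) (fun ω => (ω.1 t).2.2 ≠ g₂ (fun q => (ω.2 q).2) t) :=
    fun t => by
      rw [codeJoint_eq_law p hK W f, ← prob_comp]
  have hpe : ∀ E : Fin m → (Fin m → Fin k × S₁ × S₂) × (Fin n → Y₁ × Y₂) → Prop,
      0 ≤ 1 / (m : ℝ) * ∑ t, prob (blockJoint (iid m Q) W F) (E t) ∧
        1 / (m : ℝ) * ∑ t, prob (blockJoint (iid m Q) W F) (E t) ≤ 1 := fun E => by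
    refine ⟨mul_nonneg (by positivity) (Finset.sum_nonneg fun t _ => prob_nonneg hP.1 _), ?_⟩
    rw [one_div, inv_mul_le_iff₀ hm', mul_one]
    simpa using Finset.sum_le_sum fun t (_ : t ∈ Finset.univ) => prob_le_one hP (E t)
  simp only [p₁, p₂]
  obtain ⟨l₁, l₁'⟩ := hpe fun t ω => (ω.1 t).2.1 ≠ g₁ (fun q => (ω.2 q).1) t
  obtain ⟨l₂, l₂'⟩ := hpe fun t ω => (ω.1 t).2.2 ≠ g₂ (fun q => (ω.2 q).2) t
  have n₁ := fanoBound_nonneg (Fintype.card S₁) l₁ l₁'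
  have n₂ := fanoBound_nonneg (Fintype.card S₂) l₂ l₂'
  set φ₁ := fanoBound (Fintype.card S₁) _ with hφ₁
  set φ₂ := fanoBound (Fintype.card S₂) _ with hφ₂
  set P := blockJoint (iid m Q) W F
  let M₀ : (Fin m → Fin k × S₁ × S₂) × (Fin n → Y₁ × Y₂) → Fin m → Fin k := fun ω t => (ω.1 t).1
  let M₁ : (Fin m → Fin k × S₁ × S₂) × (Fin n → Y₁ × Y₂) → Fin m → S₁ := fun ω t => (ω.1 t).2.1
  let M₂ : (Fin m → Fin k × S₁ × S₂) × (Fin n → Y₁ × Y₂) → Fin m → S₂ := fun ω t => (ω.1 t).2.2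
  have i₁ := mutualInfo_le_of_equivocation hP M₀ M₁ fun ω q => (ω.2 q).1
  have i₂ := mutualInfo_le_of_equivocation hP M₀ M₂ fun ω q => (ω.2 q).2
  have c₁ := condEntropy_le_of_equivocation hP M₀ M₁ fun ω q => (ω.2 q).1
  have c₂ := condEntropy_le_of_equivocation hP M₀ M₂ fun ω q => (ω.2 q).2
  have c₁₂ := condEntropy_le_of_equivocation hP (fun ω => (M₀ ω, M₁ ω)) M₂ fun ω q => (ω.2 q).2
  have c₂₁ := condEntropy_le_of_equivocation hP (fun ω => (M₀ ω, M₂ ω)) M₁ fun ω q => (ω.2 q).1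
  have j₁ : mutualInfo P M₀ M₁ = m * mutualInfo Q (fun a => a.1) (fun a => a.2.1) :=
    mutualInfo_iid hQ hW F (fun a => a.1) (fun a => a.2.1)
  have j₂ : mutualInfo P M₀ M₂ = m * mutualInfo Q (fun a => a.1) (fun a => a.2.2) :=
    mutualInfo_iid hQ hW F (fun a => a.1) (fun a => a.2.2)
  have k₁ : condEntropy P M₁ M₀ = m * condEntropy Q (fun a => a.2.1) (fun a => a.1) :=
    condEntropy_iid hQ hW F (fun a => a.2.1) (fun a => a.1)
  have k₂ : condEntropy P M₂ M₀ = m * condEntropy Q (fun a => a.2.2) (fun a => a.1) :=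
    condEntropy_iid hQ hW F (fun a => a.2.2) (fun a => a.1)
  have k₃ : condEntropy P (fun ω => (M₁ ω, M₂ ω)) M₀ =
      m * condEntropy Q (fun a => a.2) (fun a => a.1) := by
    rw [← condEntropy_iid hQ hW F (fun a => a.2) (fun a => a.1)]
    refine condEntropy_congr hP (fun _ _ => Iff.rfl) fun ω ω' _ => ?_
    simp only [M₁, M₂, funext_iff, Prod.ext_iff, forall_and]
  have k₄ : condEntropy P (fun ω => (M₁ ω, M₂ ω)) M₀ = condEntropy P (fun ω => (M₂ ω, M₁ ω)) M₀ :=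
    condEntropy_congr hP (fun _ _ => Iff.rfl) fun ω ω' _ => by
      simp only [Prod.mk.injEq, and_comm]
  -- `H(S_1^m, S_2^m | U^m)` is expanded in both orders, one for each of the two sum-rate bounds.
  rw [condEntropy_chain hP] at k₃ k₄
  rw [condEntropy_chain hP] at k₄
  change condEntropy P M₁ (fun ω q => (ω.2 q).1) ≤ m * φ₁ at f₁
  change condEntropy P M₂ (fun ω q => (ω.2 q).2) ≤ m * φ₂ at f₂
  change condEntropy P _ M₀ = _ at a₀₁ a₀₂
  change condEntropy P _ (fun ω => (M₀ ω, M₁ ω)) = _ at a₁₁ a₁₂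
  change condEntropy P _ (fun ω => (M₀ ω, M₂ ω)) = _ at a₂₁ a₂₂
  change _ ≤ condEntropy P _ (fun ω => ((M₀ ω, M₂ ω), M₁ ω)) at w₁
  change _ ≤ condEntropy P _ (fun ω => ((M₀ ω, M₁ ω), M₂ ω)) at w₂
  set IS := min (mutualInfo Q (fun a => a.1) (fun a => a.2.1))
    (mutualInfo Q (fun a => a.1) (fun a => a.2.2))
  have key : ∀ A B s : ℝ, m * A ≤ n * B + m * s → A - s ≤ (n : ℝ) / m * B := fun A B s h => by
    rw [div_mul_eq_mul_div, le_div_iff₀ hm']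
    linarith
  have J₁ : m * IS ≤ m * mutualInfo Q (fun a => a.1) (fun a => a.2.1) :=
    mul_le_mul_of_nonneg_left (min_le_left _ _) hm'.le
  have J₂ : m * IS ≤ m * mutualInfo Q (fun a => a.1) (fun a => a.2.2) :=
    mul_le_mul_of_nonneg_left (min_le_right _ _) hm'.le
  have mn₁ : 0 ≤ m * φ₁ := mul_nonneg hm'.le n₁
  have mn₂ : 0 ≤ m * φ₂ := mul_nonneg hm'.le n₂
  have r0' := mul_le_mul_of_nonneg_left r0 hm'.le
  have r1' := mul_le_mul_of_nonneg_left r1 hm'.le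
  have r2' := mul_le_mul_of_nonneg_left r2 hm'.le
  have r3' := mul_le_mul_of_nonneg_left r3 hm'.le
  unfold SatisfiesScaledBounds outputEntropies
  rw [hev]
  dsimp only
  set I := min (hent (outLaw (marginal₁ W) v) - e.2.1.1) (hent (outLaw (marginal₂ W) v) - e.2.1.2)
    with hI
  -- The mutual information bounds leave `δ₀` to spare for both receivers, so it survives the
  -- minimum.
  have J : m * IS + δ₀ ≤ n * I + m * φ₁ + m * φ₂ := by
    rcases min_choice (hent (outLaw (marginal₁ W) v) - e.2.1.1)
      (hent (outLaw (marginal₂ W) v) - e.2.1.2) with h | h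
    · rw [hI, h]
      linarith
    · rw [hI, h]
      linarith
  -- The spare `δ₀` pays for the `δ₀` in `H(Y_i^n | U^m)`. The next term gives `-δ₁` or `-δ₂`, which
  -- is dropped in the two-rate bounds and cancels against the last term in the sum-rate bounds.
  -- Fano terms add up to at most `2 * (φ₁ + φ₂)` per letter: once through `J`, once through the
  -- remaining steps.
  refine ⟨key _ _ _ ?_, key _ _ _ ?_, key _ _ _ ?_, key _ _ _ ?_, key _ _ _ ?_⟩ <;> linarith

theorem _root_.IsCompact.exists_tendsto_ultrafilter {ι E : Type*} [TopologicalSpace E] {s : Set E}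
    (hs : IsCompact s) (𝒰 : Ultrafilter ι) {u : ι → E} (hu : ∀ k, u k ∈ s) :
    ∃ x ∈ s, Filter.Tendsto u 𝒰 (nhds x) :=
  hs.ultrafilter_le_nhds (𝒰.map u) (by
    rw [Ultrafilter.coe_map, Filter.le_principal_iff, Filter.mem_map]
    exact Filter.univ_mem' hu)

/-- In the limit, an admissible source satisfies the scaled outer bounds exactly, at a common
input distribution. -/
theorem exists_region_subset [Nonempty X] {p : S₁ × S₂ → ℝ}
    (hp : p ∈ stdSimplex ℝ (S₁ × S₂)) {W : X → Y₁ × Y₂ → ℝ} (hW : IsChannel W) {κ : ℝ}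
    (hadm : IsAdmissible p W κ) :
    ∃ v ∈ stdSimplex ℝ X, ∃ r : ℝ, 0 ≤ r ∧ r ≤ κ ∧ ∀ R ∈ sourceRegion p,
      ∃ e ∈ layeredHull (outputEntropies W), e.1 = v ∧ SatisfiesScaledBounds W e r 0 R := by
  choose m n hm hr f g₁ g₂ h₁ h₂ using fun k : ℕ =>
    hadm (1 / ((k : ℝ) + 1)) Nat.one_div_pos_of_nat
  choose v hv hcode using fun k => exists_satisfiesScaledBounds hp hW (hm k) (f k) (g₁ k) (g₂ k)
  -- Along one ultrafilter every sequence in a compact set converges. The limits of `v` and of the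
  -- ratio are fixed first, and the hull points depending on `R` need no further subsequence.
  let 𝒰 : Ultrafilter ℕ := Filter.hyperfilter ℕ
  have lim : Filter.Tendsto (fun k : ℕ => 1 / ((k : ℝ) + 1)) 𝒰 (nhds 0) :=
    tendsto_one_div_add_atTop_nhds_zero_nat.mono_left Nat.hyperfilter_le_atTop
  have hlim1 : ∀ k : ℕ, 1 / ((k : ℝ) + 1) ≤ 1 := fun k => by
    rw [div_le_one (by positivity)]
    linarith [(Nat.cast_nonneg k : (0 : ℝ) ≤ k)]
  have hnonneg : ∀ k ω, 0 ≤ codeJoint p W (f k) ω := fun k ω =>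
    mul_nonneg (Finset.prod_nonneg fun t _ => hp.1 _) (Finset.prod_nonneg fun q _ => hW.nonneg _ _)
  have hfano : ∀ (N : ℕ) (t : ℕ → ℝ), (∀ k, 0 ≤ t k) → (∀ k : ℕ, t k ≤ 1 / ((k : ℝ) + 1)) →
      Filter.Tendsto (fun k => fanoBound N (t k)) 𝒰 (nhds 0) := fun N t h0 h1 => by
    have ht : Filter.Tendsto t 𝒰 (nhds 0) :=
      tendsto_of_tendsto_of_tendsto_of_le_of_le tendsto_const_nhds lim h0 h1
    have := ((continuous_fanoBound N).tendsto 0).comp ht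
    rwa [fanoBound_zero] at this
  have hs₁ := hfano (Fintype.card S₁) _ (fun k => mul_nonneg (by positivity)
    (Finset.sum_nonneg fun t _ => prob_nonneg (hnonneg k) _)) h₁
  have hs₂ := hfano (Fintype.card S₂) _ (fun k => mul_nonneg (by positivity)
    (Finset.sum_nonneg fun t _ => prob_nonneg (hnonneg k) _)) h₂
  have hs := (hs₁.add hs₂).const_mul 2
  rw [add_zero, mul_zero] at hs
  obtain ⟨v', hv', hvl⟩ := (isCompact_stdSimplex ℝ X).exists_tendsto_ultrafilter 𝒰 hv
  obtain ⟨r, hr', hrl⟩ := (isCompact_Icc (a := (0 : ℝ)) (b := κ + 1)).exists_tendsto_ultrafilter 𝒰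
    (u := fun k => (n k : ℝ) / m k) fun k =>
      ⟨by positivity, (hr k).trans (by linarith [hlim1 k])⟩
  refine ⟨v', hv', r, hr'.1, ?_, fun R hR => ?_⟩
  · have := lim.const_add κ
    rw [add_zero] at this
    exact le_of_tendsto_of_tendsto' hrl this hr
  · choose e he hev hb using fun k => hcode k R hR
    obtain ⟨e', he', hel⟩ := (isCompact_layeredHull
      (continuous_outputEntropies W)).exists_tendsto_ultrafilter 𝒰 he
    refine ⟨e', he', ?_, ?_⟩
    · have := (continuous_fst.tendsto e').comp hel
      refine tendsto_nhds_unique this ?_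
      simpa only [Function.comp_def, hev] using hvl
    · exact (isClosed_satisfiesScaledBounds W R).mem_of_tendsto
        (hel.prodMk_nhds (hrl.prodMk_nhds hs)) (Filter.Eventually.of_forall hb)

end Converse

end CorrelatedBroadcast

end

open CorrelatedBroadcast in
theorem corollary2 {S₁ S₂ X Y₁ Y₂ : Type*} [Fintype S₁] [Fintype S₂] [Fintype X] [Nonempty X]
    [Fintype Y₁] [Fintype Y₂]
    (p : S₁ × S₂ → ℝ) (hp : p ∈ stdSimplex ℝ (S₁ × S₂))
    (W : X → Y₁ × Y₂ → ℝ) (hW : CorrelatedBroadcast.IsChannel W) (κ : ℝ)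
    (hadm : CorrelatedBroadcast.IsAdmissible p W κ) :
    ∃ pX : X → ℝ, pX ∈ stdSimplex ℝ X ∧
      CorrelatedBroadcast.sourceRegion p ⊆ κ • CorrelatedBroadcast.outerRegion pX W := by
  obtain ⟨v, hv, r, hr0, hrκ, h⟩ := exists_region_subset hp hW hadm
  refine ⟨v, hv, fun R hR => ?_⟩
  obtain ⟨e, he, hev, b0, b1, b2, b3, b4⟩ := h R hR
  obtain ⟨p0, p1, p2, -⟩ := hR
  rcases hr0.eq_or_lt with rfl | hr
  -- In the limit of no channel uses per source letter all rates vanish.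
  · simp only [zero_mul, sub_zero] at b0 b1 b2
    have hR0 : R = 0 := by
      ext <;> simp <;> linarith
    exact ⟨0, zero_mem_outerRegion hW hv, by simp [hR0]⟩
  have hκ : 0 < κ := hr.trans_le hrκ
  refine ⟨κ⁻¹ • R, ?_, smul_inv_smul₀ hκ.ne' R⟩
  have hk : 0 ≤ κ⁻¹ := inv_nonneg.2 hκ.le
  -- Passing from `r` to the larger `κ` needs `B ≥ 0`, which follows from `0 ≤ A ≤ r * B` and `r >
  -- 0`.
  have scale : ∀ A B : ℝ, 0 ≤ A → A - 0 ≤ r * B → κ⁻¹ * A ≤ B := fun A B hA hAB => by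
    rw [sub_zero] at hAB
    have hB : 0 ≤ B := nonneg_of_mul_nonneg_right (hA.trans hAB) hr
    rw [inv_mul_le_iff₀ hκ]
    exact hAB.trans (mul_le_mul_of_nonneg_right hrκ hB)
  subst hev
  refine mem_outerRegion_of_satisfiesOuterBounds hW he hv (mul_nonneg hk p0) (mul_nonneg hk p1)
    (mul_nonneg hk p2) ?_
  simp only [SatisfiesOuterBounds, Prod.smul_fst, Prod.smul_snd, smul_eq_mul, ← mul_add]
  exact ⟨scale _ _ p0 b0, scale _ _ (add_nonneg p0 p1) b1, scale _ _ (add_nonneg p0 p2) b2,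
    scale _ _ (add_nonneg (add_nonneg p0 p1) p2) b3,
    scale _ _ (add_nonneg (add_nonneg p0 p1) p2) b4⟩
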